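/- Let $A,B,C\in\mathbb S^2\subset\mathbb R^3$ be unit vectors with $\det M(A,B,C)>0$, where $M(U,V,W)$ denotes the $3\times3$ matrix with columns $U,V,W$, and let $\triangle ABC$ be the closed geodesic triangle on the unit sphere with these vertices. Let $S(U,V,W)$ denote the oriented (signed) area of the spherical triangle $UVW$, put $S=S(A,B,C)$, and for $X\in\mathbb S^2$ near $\triangle ABC$ let $$\lambda_A(X)=\frac{S(B,C,X)}{S},\qquad \lambda_B(X)=\frac{S(C,A,X)}{S}$$ be the barycentric coordinates belonging to $A$ and $B$. Let $M_A(X)=M(B,C,X)$, $M_B(X)=M(C,A,X)$, $$F_{BC}(X)=\Big[1-\frac{C\cdot(X+B)}{1+B\cdot X}\Big]B+\Big[1-\frac{B\cdot(X+C)}{1+C\cdot X}\Big]C,$$ and let $F_{CA}(X)$ be the vector obtained from $F_{BC}(X)$ by replacing $(B,C)$ by $(C,A)$. Let $dX$ be the vector-valued 1-form on the sphere that sends a vector at $X$ to its tangential part, let $\mathrm{vol}^2$, $\mathrm{vol}^2_X(u,v)=\det M(X,u,v)$, be the area 2-form of $\mathbb S^2$, and let $$\lambda_{ABC}=d\lambda_{AB},\qquad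 \lambda_{AB}=\lambda_A\,d\lambda_B-\lambda_B\,d\lambda_A,$$ be the Whitney 2-form of the triangle. Then: 1. $\lambda_A$ and $\lambda_B$ are smooth at every point of $\triangle ABC$, and there $\lambda_{ABC}=2\,d\lambda_A\wedge d\lambda_B$. 2. At every point $X$ of $\triangle ABC$ with $\det M_A(X)\ne0$ and $\det M_B(X)\neq 0$ (that is, not on the sides $BC$ and $CA$, where the expressions below are of the form $0/0$), $$\lambda_{ABC}=\frac{2}{S^2\det(M_AM_B)}\,(F_{BC}\cdot dX)\wedge(F_{CA}\cdot dX)=\frac{\omega_{ABC}(X)}{S}\,\mathrm{vol}^2,$$ $$\omega_{ABC}(X)=\frac{2\det M\big(F_{BC}(X),F_{CA}(X),X\big)}{S\,\det\big[M(B,C,X)\,M(C,A,X)\big]}.$$ 3. $\omega_{ABC}$ is a rational function of the Cartesian coordinates of $X$: there are polynomials $P,Q\in\mathbb R[x_1,x_2,x_3]$ such that $Q(X)\ne0$ and $\omega_{ABC}(X)=P(X)/Q(X)$ for all $X\in\mathbb R^3$ at which none of $1+A\cdot X$, $1+B\cdot X$, $1+C\cdot X$, $\det M_A(X)$, $\det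 M_B(X)$ vanishes. 4. The Whitney 2-form is integrable over the triangle, and, with the outward orientation of the sphere, $\int_{\triangle ABC}\lambda_{ABC}=1$; equivalently $\int_{\triangle ABC}\frac{\omega_{ABC}}{S}\,d\sigma=1$, with $\sigma$ the area measure of the sphere. -/

import Mathlib

open scoped ContDiff

noncomputable section

namespace SphericalWhitney

/-- Euclidean three-space. -/
abbrev R3 := EuclideanSpace ℝ (Fin 3)

/-- The unit sphere `𝕊²` in `ℝ³`. -/
abbrev S2 := Metric.sphere (0 : R3) 1

/-- The matrix `M(U, V, W)` whose columns are `U`, `V`, `W`. -/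
def M (U V W : R3) : Matrix (Fin 3) (Fin 3) ℝ :=
  Matrix.of fun i j => (![U, V, W] j) i

/-- The area measure of `𝕊²` (total mass `4π`). -/
def sphereArea : MeasureTheory.Measure S2 :=
  (MeasureTheory.volume : MeasureTheory.Measure R3).toSphere

/-- The (closed, geodesic) spherical triangle with vertices `A`, `B`, `C`: the points of the sphere
that lie in the cone spanned by the vertices. -/
def triangle (A B C : R3) : Set S2 :=
  {X | ∃ a b c : ℝ, 0 ≤ a ∧ 0 ≤ b ∧ 0 ≤ c ∧ (X : R3) = a • A + b • B + c • C}

/-- The oriented (signed) area `S(A, B, C)` of a spherical triangle: its area,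
with the sign of the orientation of `(A, B, C)`. -/
def signedArea (A B C : R3) : ℝ :=
  (SignType.sign (M A B C).det : ℝ) * sphereArea.real (triangle A B C)

/-- The barycentric coordinate `λ_A(X) = S(B, C, X) / S(A, B, C)`. -/
def lamA (A B C X : R3) : ℝ := signedArea B C X / signedArea A B C

/-- The barycentric coordinate `λ_B(X) = S(C, A, X) / S(A, B, C)`. -/
def lamB (A B C X : R3) : ℝ := signedArea C A X / signedArea A B C

/-! ### Differential forms on the sphere

A form on the sphere is written as a family of alternating maps on `ℝ³`, indexed by the point `X`,
of which only the values at unit vectors `X` and on vectors tangent to the sphere at `X` matter.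
Its exterior derivative is computed by pulling it back along the radial retraction `x ↦ x / ‖x‖` of
`ℝ³ ∖ {0}` onto the sphere, and differentiating in `ℝ³`; exterior differentiation
commutes with this pullback and with restriction to the sphere. -/

/-- The radial retraction `X = x / ‖x‖` of `ℝ³ ∖ {0}` onto the unit sphere. -/
def radial (x : R3) : R3 := ‖x‖⁻¹ • x

/-- The vector-valued 1-form `dX` on the sphere (see `dX_apply`: it returns the tangential part). -/
def dX (X : R3) : R3 →L[ℝ] R3 := fderiv ℝ radial X

/-- The differential at `X` of a scalar function on the sphere. -/
def sphereD (f : R3 → ℝ) (X : R3) : R3 →L[ℝ] ℝ := fderiv ℝ (f ∘ radial) X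

/-- The 1-form `V · dX` at the point `X`. -/
def dotdX (V X : R3) : R3 →L[ℝ] ℝ := (innerSL ℝ V).comp (dX X)

/-- A covector, as an alternating map in one variable. -/
def toOneForm (α : R3 →L[ℝ] ℝ) : R3 [⋀^Fin 1]→L[ℝ] ℝ :=
  ContinuousAlternatingMap.ofSubsingleton ℝ R3 ℝ (0 : Fin 1) α

/-- The wedge product of two covectors (see `wedge_apply`). -/
def wedge (α β : R3 →L[ℝ] ℝ) : R3 [⋀^Fin 2]→L[ℝ] ℝ :=
  ContinuousAlternatingMap.alternatizeUncurryFin (α.smulRight (toOneForm β))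

theorem wedge_apply (α β : R3 →L[ℝ] ℝ) (v : Fin 2 → R3) :
    wedge α β v = α (v 0) * β (v 1) - α (v 1) * β (v 0) := by
  simp [wedge, toOneForm, ContinuousAlternatingMap.alternatizeUncurryFin_apply, Fin.sum_univ_two,
    Fin.removeNth, sub_eq_add_neg]

/-- The exterior derivative of a form on the sphere. -/
def sphereExtDeriv {n : ℕ} (η : R3 → R3 [⋀^Fin n]→L[ℝ] ℝ) (X : R3) :
    R3 [⋀^Fin (n + 1)]→L[ℝ] ℝ :=
  extDeriv (fun x => (η (radial x)).compContinuousLinearMap (dX x)) X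

/-- The coordinate covectors `dx_i` of `ℝ³`. -/
def coord (i : Fin 3) : R3 →L[ℝ] ℝ := EuclideanSpace.proj i

/-- The area 2-form `vol²` of the sphere at `X`, that is `(u, v) ↦ det M(X, u, v)`
(see `vol2_apply`). -/
def vol2 (X : R3) : R3 [⋀^Fin 2]→L[ℝ] ℝ :=
  ∑ i : Fin 3, X i • wedge (coord (i + 1)) (coord (i + 2))

theorem vol2_apply (X u v : R3) : vol2 X ![u, v] = (M X u v).det := by
  simp [vol2, wedge_apply, coord, Fin.sum_univ_three, M, Matrix.det_fin_three]
  ring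

/-- The density, with respect to the oriented area, of a 2-form `η` on the tangent plane of the
sphere at `X`: its value on a positively oriented orthonormal basis of that plane
(see `density_eq`). -/
def density (η : R3 [⋀^Fin 2]→L[ℝ] ℝ) (X : R3) : ℝ :=
  ∑ i : Fin 3, X i * η ![dX X (EuclideanSpace.single (i + 1) 1),
    dX X (EuclideanSpace.single (i + 2) 1)]

/-- The integral of a 2-form on the sphere, oriented by the outward normal, over a set `T`. -/
def integral2 (T : Set S2) (η : R3 → R3 [⋀^Fin 2]→L[ℝ] ℝ) : ℝ :=
  ∫ X in T, density (η X) X ∂sphereArea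

theorem dX_apply {X : R3} (hX : ‖X‖ = 1) (V : R3) : dX X V = V - inner ℝ X V • X := by
  have h0 : X ≠ 0 := by
    rintro rfl
    simp at hX
  have h1 : HasFDerivAt (fun x : R3 => ‖x‖ ^ 2) ((2 : ℕ) • (innerSL ℝ X)) X :=
    (hasStrictFDerivAt_norm_sq X).hasFDerivAt
  have h2 : HasFDerivAt (fun x : R3 => ‖x‖⁻¹) (-(innerSL ℝ X)) X := by
    have h3 : HasDerivAt (fun t : ℝ => (Real.sqrt t)⁻¹) (-(1 / 2)) (‖X‖ ^ 2) := by
      have h4 := (Real.hasDerivAt_sqrt (x := ‖X‖ ^ 2) (by simp [hX])).inv (by simp [hX])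
      refine h4.congr_deriv ?_
      simp [hX]
    have h5 := h3.comp_hasFDerivAt X h1
    have h6 : ((fun t : ℝ => (Real.sqrt t)⁻¹) ∘ fun x : R3 => ‖x‖ ^ 2) = fun x : R3 => ‖x‖⁻¹ := by
      funext x
      simp
    rw [h6] at h5
    refine h5.congr_fderiv ?_
    ext v
    simp
    try ring
  have h7 := (h2.smul (hasFDerivAt_id X)).fderiv
  have h8 : dX X = fderiv ℝ (fun x : R3 => ‖x‖⁻¹ • id x) X := rfl
  rw [h8]
  erw [h7]
  simp [hX, sub_eq_add_neg]

theorem density_eq {X u v : R3} (hX : ‖X‖ = 1) (hu : ‖u‖ = 1) (hv : ‖v‖ = 1)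
    (hXu : inner ℝ X u = 0) (hXv : inner ℝ X v = 0) (huv : inner ℝ u v = 0)
    (hpos : 0 < (M X u v).det) (η : R3 [⋀^Fin 2]→L[ℝ] ℝ) : density η X = η ![u, v] := by
  have e1 : (M X u v).transpose * M X u v = 1 := by
    have hX' := real_inner_self_eq_norm_sq X
    have hu' := real_inner_self_eq_norm_sq u
    have hv' := real_inner_self_eq_norm_sq v
    rw [hX] at hX'
    rw [hu] at hu'
    rw [hv] at hv'
    simp only [PiLp.inner_apply, RCLike.inner_apply, conj_trivial, Fin.sum_univ_three] at *
    ext i j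
    fin_cases i <;> fin_cases j <;>
      simp [M, Matrix.mul_apply, Fin.sum_univ_three] <;> linarith
  have e2 : M X u v * (M X u v).transpose = 1 := mul_eq_one_comm.mp e1
  have hd : (M X u v).det = 1 := by
    have := congrArg Matrix.det e1
    rw [Matrix.det_mul, Matrix.det_transpose, Matrix.det_one] at this
    nlinarith
  have key : ∀ i, dX X (EuclideanSpace.single i 1) = u i • u + v i • v := by
    intro i
    rw [dX_apply hX]
    ext j
    have := congrFun (congrFun e2 i) j
    simp only [M, Matrix.mul_apply, Fin.sum_univ_three, Matrix.transpose_apply, Matrix.of_apply,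
      Matrix.cons_val_zero, Matrix.cons_val_one, Matrix.cons_val, Matrix.one_apply] at this
    simp only [EuclideanSpace.inner_single_right, PiLp.sub_apply, PiLp.add_apply, PiLp.smul_apply,
      PiLp.single_apply, smul_eq_mul, conj_trivial, one_mul]
    by_cases hij : i = j
    · subst hij
      simp at this ⊢
      linarith
    · have hji : ¬ j = i := fun h => hij h.symm
      simp [hij, hji] at this ⊢
      linarith
  have bil : ∀ a b c d : ℝ, η ![a • u + b • v, c • u + d • v] = (a * d - b * c) * η ![u, v] := by
    intro a b c d
    have huu : η ![u, u] = 0 := η.map_eq_zero_of_eq _ (i := 0) (j := 1) rfl (by decide)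
    have hvv : η ![v, v] = 0 := η.map_eq_zero_of_eq _ (i := 0) (j := 1) rfl (by decide)
    have hvu : η ![v, u] = - η ![u, v] := by
      have := η.toAlternatingMap.map_swap ![u, v] (i := 0) (j := 1) (by decide)
      have h : (![u, v] ∘ Equiv.swap (0 : Fin 2) 1) = ![v, u] := by
        ext k
        fin_cases k <;> simp
      rw [h] at this
      exact this
    have l1 : ∀ p q w : R3, ∀ s t : ℝ,
        η ![s • p + t • q, w] = s * η ![p, w] + t * η ![q, w] := by
      intro p q w s t
      have h1 := η.toMultilinearMap.cons_add ![w] (s • p) (t • q)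
      have h2 := η.toMultilinearMap.cons_smul ![w] s p
      have h3 := η.toMultilinearMap.cons_smul ![w] t q
      rw [h2, h3] at h1
      exact h1
    have sw : ∀ p q : R3, η ![p, q] = - η ![q, p] := by
      intro p q
      have := η.toAlternatingMap.map_swap ![q, p] (i := 0) (j := 1) (by decide)
      have h : (![q, p] ∘ Equiv.swap (0 : Fin 2) 1) = ![p, q] := by
        ext k
        fin_cases k <;> simp
      rw [h] at this
      exact this
    rw [l1, sw u (c • u + d • v), l1, sw v (c • u + d • v), l1, huu, hvv, hvu]
    ring
  have hd' := hd
  simp [M, Matrix.det_fin_three] at hd'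
  simp only [density, key, bil, Fin.sum_univ_three]
  have f1 : (1 : Fin 3) + 1 = 2 := rfl
  have f2 : (1 : Fin 3) + 2 = 0 := rfl
  have f3 : (2 : Fin 3) + 1 = 0 := rfl
  have f4 : (2 : Fin 3) + 2 = 1 := rfl
  simp only [zero_add, f1, f2, f3, f4]
  linear_combination (η ![u, v]) * hd'

/-! ### Whitney forms -/

/-- The Whitney 1-form `λ_AB = λ_A dλ_B - λ_B dλ_A`. -/
def whitneyAB (A B C X : R3) : R3 →L[ℝ] ℝ :=
  lamA A B C X • sphereD (lamB A B C) X - lamB A B C X • sphereD (lamA A B C) X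

/-- The Whitney 2-form `λ_ABC = dλ_AB`. -/
def whitneyABC (A B C X : R3) : R3 [⋀^Fin 2]→L[ℝ] ℝ :=
  sphereExtDeriv (fun Y => toOneForm (whitneyAB A B C Y)) X

/-- The vector function `F_BC(X)`. -/
def F (B C X : R3) : R3 :=
  (1 - inner ℝ C (X + B) / (1 + inner ℝ B X)) • B +
    (1 - inner ℝ B (X + C) / (1 + inner ℝ C X)) • C

/-- The function `ω_ABC(X)`. -/
def omegaABC (A B C X : R3) : ℝ :=
  2 * (M (F B C X) (F C A X) X).det / (signedArea A B C * (M B C X * M C A X).det)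

end SphericalWhitney

end

open SphericalWhitney

noncomputable section

namespace SphericalWhitney

/-! ### Determinants, wedge products and densities -/

section

/-! Everything rests on a closed form for the spherical excess: the signed area of `BCX` is `2 * arg
Z`, where `Z = areaPhase B C X` has real part `1 + B·C + C·X + X·B` and imaginary part `det M(B, C,
X)`. Since areas are defined by a measure, the formula has to be integrated out. The cone over the
triangle is parametrized by the unit square and a radius; the radial integral and one square
variable are elementary, and the integrand left over is the derivative of twice an explicit argument
(`integral_eq_arg`, `area_triangle`, `signedArea_eq`).

`Z` is affine in `X` and stays in the slit plane over the closed triangle, sides included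
(`areaPhase_mem_slitPlane`), so the barycentric coordinates are smooth there. Differentiating `2 Im
log Z`, and using that `|Z|²` factors as `2 (1 + B·C) (1 + C·X) (1 + X·B)`, gives `det M(B, C, X) dS
= -F_BC · dX` (`det_smul_sphereD_signedArea`). The formulas for the 2-form follow from `d(f dg - g
df) = 2 df ∧ dg` and from a Gram identity that turns `(V·dX) ∧ (W·dX)` into `det M(V, W, X) vol²`.
Rationality is a matter of clearing the denominators of `F`.

For the integral, the form is pulled back to the square and `2 dλ_A ∧ dλ_B = d(2 λ_A dλ_B)` is
integrated by Green's theorem. Since `λ_A = 0` on `BC`, `λ_B = 0` on `CA` and `λ_A + λ_B = 1` on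
`AB`, only the side `AB` contributes, and it contributes `∫ 2 (1 - λ_B) dλ_B = 1`. -/

theorem inner_eq_sum (U V : R3) : inner ℝ U V = U 0 * V 0 + U 1 * V 1 + U 2 * V 2 := by
  simp only [PiLp.inner_apply, RCLike.inner_apply, conj_trivial, Fin.sum_univ_three]
  ring

theorem det_M (U V W : R3) : (M U V W).det =
    U 0 * (V 1 * W 2 - V 2 * W 1) + U 1 * (V 2 * W 0 - V 0 * W 2)
      + U 2 * (V 0 * W 1 - V 1 * W 0) := by
  simp [M, Matrix.det_fin_three]
  ring

theorem det_M_cycle (U V W : R3) : (M V W U).det = (M U V W).det := by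
  simp only [det_M]
  ring

theorem det_M_swap (U V W : R3) : (M V U W).det = -(M U V W).det := by
  simp only [det_M]
  ring

theorem det_M_comb (U V W : R3) (a b c : ℝ) :
    (M U V (a • U + b • V + c • W)).det = c * (M U V W).det := by
  simp only [det_M, PiLp.add_apply, PiLp.smul_apply, smul_eq_mul]
  ring

theorem det_M_mul_det_M (U V W U' V' W' : R3) :
    (M U V W).det * (M U' V' W').det =
      inner ℝ U U' * (inner ℝ V V' * inner ℝ W W' - inner ℝ V W' * inner ℝ W V')
      - inner ℝ U V' * (inner ℝ V U' * inner ℝ W W' - inner ℝ V W' * inner ℝ W U')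
      + inner ℝ U W' * (inner ℝ V U' * inner ℝ W V' - inner ℝ V V' * inner ℝ W U') := by
  simp only [det_M, inner_eq_sum]
  ring

theorem inner_self_eq_one {X : R3} (hX : ‖X‖ = 1) : inner ℝ X X = (1 : ℝ) := by
  rw [real_inner_self_eq_norm_sq, hX]
  norm_num

/-- The product `det M(X, V, W) * det M(X, u, v)` is a Gram determinant; with `X·X = 1` it becomes
the 2×2 determinant of the inner products of `V`, `W` with the tangential parts of `u`, `v`. -/
theorem wedge_dotdX (V W : R3) {X : R3} (hX : ‖X‖ = 1) :
    wedge (dotdX V X) (dotdX W X) = (M V W X).det • vol2 X := by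
  have h1 := inner_self_eq_one hX
  ext v
  have hv : v = ![v 0, v 1] := by
    ext i
    fin_cases i <;> rfl
  rw [wedge_apply, ContinuousAlternatingMap.smul_apply]
  conv_rhs => rw [hv, vol2_apply]
  simp only [dotdX, ContinuousLinearMap.comp_apply, innerSL_apply_apply, dX_apply hX,
    inner_sub_right, inner_smul_right, smul_eq_mul]
  rw [det_M_cycle X V W, det_M_mul_det_M, h1]
  ring

theorem density_smul (c : ℝ) (η : R3 [⋀^Fin 2]→L[ℝ] ℝ) (X : R3) :
    density (c • η) X = c * density η X := by
  simp only [density, ContinuousAlternatingMap.smul_apply, smul_eq_mul, Fin.sum_univ_three]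
  ring

/-- The family `e` need not be a basis: it will be the three projected coordinate vectors, which are
linearly dependent. -/
theorem alternating_eq_sum (η : R3 [⋀^Fin 2]→L[ℝ] ℝ) (u v : R3) (e : Fin 3 → R3) :
    η ![u 0 • e 0 + u 1 • e 1 + u 2 • e 2, v 0 • e 0 + v 1 • e 1 + v 2 • e 2] =
      (u 1 * v 2 - u 2 * v 1) * η ![e 1, e 2] + (u 2 * v 0 - u 0 * v 2) * η ![e 2, e 0]
      + (u 0 * v 1 - u 1 * v 0) * η ![e 0, e 1] := by
  have sw : ∀ p q : R3, η ![p, q] = - η ![q, p] := by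
    intro p q
    have := η.toAlternatingMap.map_swap ![q, p] (i := 0) (j := 1) (by decide)
    have h : (![q, p] ∘ Equiv.swap (0 : Fin 2) 1) = ![p, q] := by
      ext k
      fin_cases k <;> simp
    rw [h] at this
    exact this
  have se : ∀ p : R3, η ![p, p] = 0 := fun p =>
    η.map_eq_zero_of_eq _ (i := 0) (j := 1) rfl (by decide)
  have l1 : ∀ p q w : R3, η ![p + q, w] = η ![p, w] + η ![q, w] := fun p q w =>
    η.toMultilinearMap.cons_add ![w] p q
  have l2 : ∀ (a : ℝ) (p w : R3), η ![a • p, w] = a * η ![p, w] := fun a p w =>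
    η.toMultilinearMap.cons_smul ![w] a p
  have r1 : ∀ p q w : R3, η ![w, p + q] = η ![w, p] + η ![w, q] := by
    intro p q w
    rw [sw, l1, sw p, sw q]
    ring
  have r2 : ∀ (a : ℝ) (p w : R3), η ![w, a • p] = a * η ![w, p] := by
    intro a p w
    rw [sw, l2, sw p]
    ring
  simp only [l1, l2, r1, r2, se]
  rw [sw (e 1) (e 0), sw (e 0) (e 2), sw (e 2) (e 1)]
  ring

theorem alternating_eq_density_mul (η : R3 [⋀^Fin 2]→L[ℝ] ℝ) {X u v : R3} (hX : ‖X‖ = 1)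
    (hu : inner ℝ X u = 0) (hv : inner ℝ X v = 0) :
    η ![u, v] = density η X * (M X u v).det := by
  have key : ∀ w : R3, inner ℝ X w = 0 →
      w = w 0 • dX X (EuclideanSpace.single 0 1) + w 1 • dX X (EuclideanSpace.single 1 1)
        + w 2 • dX X (EuclideanSpace.single 2 1) := by
    intro w hw
    have h1 : w = w 0 • EuclideanSpace.single 0 (1 : ℝ) + w 1 • EuclideanSpace.single 1 (1 : ℝ)
        + w 2 • EuclideanSpace.single 2 (1 : ℝ) := by
      ext i
      fin_cases i <;> simp
    have h2 : dX X w = w := by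
      rw [dX_apply hX, hw]
      simp
    conv_lhs => rw [← h2, h1]
    simp only [map_add, map_smul]
  have hx := inner_self_eq_one hX
  -- For tangent `u` and `v` the cross product `u × v` is a multiple of `X`.
  have cross : ∀ i : Fin 3, u (i + 1) * v (i + 2) - u (i + 2) * v (i + 1) =
      (M X u v).det * X i := by
    rw [inner_eq_sum] at hu hv hx
    intro i
    fin_cases i <;> simp [det_M]
    · linear_combination (-(u 1 * v 2 - u 2 * v 1)) * hx
        + (X 1 * v 2 - X 2 * v 1) * hu - (X 1 * u 2 - X 2 * u 1) * hv
    · linear_combination (-(u 2 * v 0 - u 0 * v 2)) * hx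
        + (X 2 * v 0 - X 0 * v 2) * hu - (X 2 * u 0 - X 0 * u 2) * hv
    · linear_combination (-(u 0 * v 1 - u 1 * v 0)) * hx
        + (X 0 * v 1 - X 1 * v 0) * hu - (X 0 * u 1 - X 1 * u 0) * hv
  conv_lhs => rw [key u hu, key v hv]
  rw [alternating_eq_sum η u v fun i => dX X (EuclideanSpace.single i 1)]
  have c0 := cross 0
  have c1 := cross 1
  have c2 := cross 2
  simp only [zero_add, show (1 : Fin 3) + 1 = 2 from rfl, show (1 : Fin 3) + 2 = 0 from rfl,
    show (2 : Fin 3) + 1 = 0 from rfl, show (2 : Fin 3) + 2 = 1 from rfl] at c0 c1 c2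
  rw [c0, c1, c2]
  simp only [density, Fin.sum_univ_three, zero_add, show (1 : Fin 3) + 1 = 2 from rfl,
    show (1 : Fin 3) + 2 = 0 from rfl,
    show (2 : Fin 3) + 1 = 0 from rfl, show (2 : Fin 3) + 2 = 1 from rfl]
  ring

theorem density_vol2 {X : R3} (hX : ‖X‖ = 1) : density (vol2 X) X = 1 := by
  have hx := inner_self_eq_one hX
  rw [inner_eq_sum] at hx
  have h : ∀ i j, dX X (EuclideanSpace.single i 1) j =
      (if j = i then 1 else 0) - X i * X j := by
    intro i j
    rw [dX_apply hX, EuclideanSpace.inner_single_right]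
    simp [PiLp.single_apply]
  simp only [density, vol2_apply, Fin.sum_univ_three, zero_add, show (1 : Fin 3) + 1 = 2 from rfl,
    show (1 : Fin 3) + 2 = 0 from rfl, det_M, h,
    show (2 : Fin 3) + 1 = 0 from rfl, show (2 : Fin 3) + 2 = 1 from rfl]
  simp
  linear_combination hx

/-- The complex number whose argument is half the signed area of the triangle `B`, `C`, `X`. -/
def areaPhase (B C X : R3) : ℂ :=
  ⟨1 + inner ℝ B C + inner ℝ C X + inner ℝ X B, (M B C X).det⟩

theorem det_M_sq {B C X : R3} (hB : ‖B‖ = 1) (hC : ‖C‖ = 1) (hX : ‖X‖ = 1) :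
    (M B C X).det ^ 2 = 1 - inner ℝ B C ^ 2 - inner ℝ C X ^ 2 - inner ℝ X B ^ 2
      + 2 * inner ℝ B C * inner ℝ C X * inner ℝ X B := by
  rw [sq, det_M_mul_det_M, inner_self_eq_one hB, inner_self_eq_one hC, inner_self_eq_one hX,
    real_inner_comm B C, real_inner_comm C X, real_inner_comm X B]
  ring

/-- The squared determinant is a Gram determinant, and adding the square of the real part makes the
sum factor. The last two factors are the denominators that occur in `F`. -/
theorem normSq_areaPhase {B C X : R3} (hB : ‖B‖ = 1) (hC : ‖C‖ = 1) (hX : ‖X‖ = 1) :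
    Complex.normSq (areaPhase B C X) =
      2 * (1 + inner ℝ B C) * (1 + inner ℝ C X) * (1 + inner ℝ X B) := by
  rw [Complex.normSq_apply]
  have := det_M_sq hB hC hX
  simp only [areaPhase]
  linear_combination this

/-- This is the algebra behind the differential of the area: the bracket is `Im (conj Z * dZ(v))`.
Multiplying by the determinant turns it into Gram determinants, hence into inner products, where
`X·v = 0` removes the remaining terms. -/
theorem inner_F_mul {B C X v : R3} (hB : ‖B‖ = 1) (hC : ‖C‖ = 1) (hX : ‖X‖ = 1)
    (hv : inner ℝ X v = 0) (h1 : 1 + inner ℝ B X ≠ 0) (h2 : 1 + inner ℝ C X ≠ 0) :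
    2 * ((areaPhase B C X).re * (M B C v).det - (areaPhase B C X).im * inner ℝ (B + C) v)
      * (M B C X).det = - Complex.normSq (areaPhase B C X) * inner ℝ (F B C X) v := by
  rw [normSq_areaPhase hB hC hX]
  have g1 := det_M_sq hB hC hX
  have g2 : (M B C X).det * (M B C v).det = _ := det_M_mul_det_M B C X B C v
  rw [hv, inner_self_eq_one hB, inner_self_eq_one hC] at g2
  simp only [areaPhase, F, inner_add_left, inner_add_right, inner_smul_left, conj_trivial]
  rw [real_inner_comm B X, real_inner_comm B C, real_inner_comm C X] at *
  have h3 : (1 + inner ℝ C X) * (1 + inner ℝ B X) *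
      ((1 - (inner ℝ C X + inner ℝ B C) / (1 + inner ℝ B X)) * inner ℝ B v +
        (1 - (inner ℝ B X + inner ℝ B C) / (1 + inner ℝ C X)) * inner ℝ C v) =
      (1 + inner ℝ C X) * (1 + inner ℝ B X - inner ℝ C X - inner ℝ B C) * inner ℝ B v +
      (1 + inner ℝ B X) * (1 + inner ℝ C X - inner ℝ B X - inner ℝ B C) * inner ℝ C v := by
    field_simp
    ring
  linear_combination 2 * (1 + inner ℝ B C) * h3
    + 2 * (1 + inner ℝ B C + inner ℝ C X + inner ℝ B X) * g2
    - 2 * (inner ℝ B v + inner ℝ C v) * g1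

end

/-! ### The cone over a triangle -/

section

open MeasureTheory Set

/-- The linear functional `X ↦ det M(U, V, X)`. -/
def detLast (U V : R3) : R3 →ₗ[ℝ] ℝ :=
  IsLinearMap.mk' (fun X => (M U V X).det)
    ⟨fun x y => by simp only [det_M, PiLp.add_apply]; ring,
     fun c x => by simp only [det_M, PiLp.smul_apply, smul_eq_mul]; ring⟩

theorem detLast_apply (U V X : R3) : detLast U V X = (M U V X).det := rfl

theorem continuous_detLast (U V : R3) : Continuous fun X : R3 => (M U V X).det :=
  (detLast U V).continuous_of_finiteDimensional

theorem continuous_detLast_coe (U V : R3) : Continuous fun X : S2 => (M U V X).det :=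
  (continuous_detLast U V).comp continuous_subtype_val

/-- A great circle has area zero. -/
theorem sphereArea_greatCircle {U V W : R3} (h : (M U V W).det ≠ 0) :
    sphereArea {X : S2 | (M U V X).det = 0} = 0 := by
  have hm : MeasurableSet {X : S2 | (M U V X).det = 0} :=
    (isClosed_eq (continuous_detLast_coe U V) continuous_const).measurableSet
  rw [sphereArea, Measure.toSphere_apply' _ hm]
  have h0 : (volume : Measure R3) (LinearMap.ker (detLast U V) : Set R3) = 0 := by
    apply Measure.addHaar_submodule
    intro htop
    apply h
    have : W ∈ LinearMap.ker (detLast U V) := htop ▸ Submodule.mem_top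
    exact this
  rw [measure_mono_null _ h0, mul_zero]
  rintro _ ⟨r, -, _, ⟨X, hX, rfl⟩, rfl⟩
  have hX' : detLast U V (X : R3) = 0 := hX
  simp [hX']

theorem det_M_comb_left (A B C : R3) (a b c : ℝ) :
    (M B C (a • A + b • B + c • C)).det = a * (M A B C).det := by
  simp only [det_M, PiLp.add_apply, PiLp.smul_apply, smul_eq_mul]
  ring

theorem det_M_comb_mid (A B C : R3) (a b c : ℝ) :
    (M C A (a • A + b • B + c • C)).det = b * (M A B C).det := by
  simp only [det_M, PiLp.add_apply, PiLp.smul_apply, smul_eq_mul]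
  ring

theorem comb_ne_zero {A B C : R3} (h : (M A B C).det ≠ 0) {a b c : ℝ}
    (habc : ¬ (a = 0 ∧ b = 0 ∧ c = 0)) : a • A + b • B + c • C ≠ 0 := by
  intro h0
  have z : ∀ U V : R3, (M U V 0).det = 0 := fun U V => by simp [det_M]
  have h1 := det_M_comb_left A B C a b c
  have h2 := det_M_comb_mid A B C a b c
  have h3 := det_M_comb A B C a b c
  rw [h0, z] at h1 h2 h3
  refine habc ⟨?_, ?_, ?_⟩
  · simpa [h] using h1.symm
  · simpa [h] using h2.symm
  · simpa [h] using h3.symm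

/-- The interior of a spherical triangle. -/
def openTriangle (A B C : R3) : Set S2 :=
  {X | ∃ a b c : ℝ, 0 < a ∧ 0 < b ∧ 0 < c ∧ (X : R3) = a • A + b • B + c • C}

/-- Cramer's rule. -/
theorem eq_comb {A B C : R3} (h : (M A B C).det ≠ 0) (X : R3) :
    X = ((M B C X).det / (M A B C).det) • A + ((M C A X).det / (M A B C).det) • B
      + ((M A B X).det / (M A B C).det) • C := by
  have h' := h
  rw [det_M] at h'
  ext i
  simp only [det_M, PiLp.add_apply, PiLp.smul_apply, smul_eq_mul]
  rw [div_mul_eq_mul_div, div_mul_eq_mul_div, div_mul_eq_mul_div, ← add_div, ← add_div,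
    eq_div_iff h']
  fin_cases i <;> simp <;> ring

theorem mem_triangle_iff {A B C : R3} (h : 0 < (M A B C).det) (X : S2) :
    X ∈ triangle A B C ↔
      0 ≤ (M B C X).det ∧ 0 ≤ (M C A X).det ∧ 0 ≤ (M A B X).det := by
  constructor
  · rintro ⟨a, b, c, ha, hb, hc, hX⟩
    rw [hX, det_M_comb, det_M_comb_left, det_M_comb_mid]
    exact ⟨by positivity, by positivity, by positivity⟩
  · rintro ⟨ha, hb, hc⟩
    exact ⟨_, _, _, by positivity, by positivity, by positivity, eq_comb h.ne' X⟩

theorem mem_openTriangle_iff {A B C : R3} (h : 0 < (M A B C).det) (X : S2) :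
    X ∈ openTriangle A B C ↔
      0 < (M B C X).det ∧ 0 < (M C A X).det ∧ 0 < (M A B X).det := by
  constructor
  · rintro ⟨a, b, c, ha, hb, hc, hX⟩
    rw [hX, det_M_comb, det_M_comb_left, det_M_comb_mid]
    exact ⟨by positivity, by positivity, by positivity⟩
  · rintro ⟨ha, hb, hc⟩
    exact ⟨_, _, _, by positivity, by positivity, by positivity, eq_comb h.ne' X⟩

theorem isClosed_triangle {A B C : R3} (h : 0 < (M A B C).det) : IsClosed (triangle A B C) := by
  have : triangle A B C = {X : S2 | 0 ≤ (M B C X).det} ∩ ({X : S2 | 0 ≤ (M C A X).det} ∩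
      {X : S2 | 0 ≤ (M A B X).det}) := by
    ext X
    exact mem_triangle_iff h X
  rw [this]
  exact (isClosed_le continuous_const (continuous_detLast_coe _ _)).inter
    ((isClosed_le continuous_const (continuous_detLast_coe _ _)).inter
      (isClosed_le continuous_const (continuous_detLast_coe _ _)))

theorem measurableSet_openTriangle {A B C : R3} (h : 0 < (M A B C).det) :
    MeasurableSet (openTriangle A B C) := by
  have : openTriangle A B C = {X : S2 | 0 < (M B C X).det} ∩ ({X : S2 | 0 < (M C A X).det} ∩
      {X : S2 | 0 < (M A B X).det}) := by
    ext X
    exact mem_openTriangle_iff h X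
  rw [this]
  exact ((isOpen_lt continuous_const (continuous_detLast_coe _ _)).inter
    ((isOpen_lt continuous_const (continuous_detLast_coe _ _)).inter
      (isOpen_lt continuous_const (continuous_detLast_coe _ _)))).measurableSet

theorem ae_det_ne_zero {A B C : R3} (h : 0 < (M A B C).det) :
    ∀ᵐ X : S2 ∂sphereArea, (M B C X).det ≠ 0 ∧ (M C A X).det ≠ 0 ∧ (M A B X).det ≠ 0 := by
  have hB : (M B C A).det ≠ 0 := by rw [det_M_cycle]; exact h.ne'
  have hC : (M C A B).det ≠ 0 := by rw [det_M_cycle, det_M_cycle]; exact h.ne'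
  have h1 := compl_mem_ae_iff.mpr (sphereArea_greatCircle hB)
  have h2 := compl_mem_ae_iff.mpr (sphereArea_greatCircle hC)
  have h3 := compl_mem_ae_iff.mpr (sphereArea_greatCircle h.ne')
  filter_upwards [h1, h2, h3] with X x1 x2 x3
  exact ⟨x1, x2, x3⟩

/-- The sides lie on great circles, which are null sets. The interior is preferred because the open
square parametrizes it injectively. -/
theorem openTriangle_ae_eq {A B C : R3} (h : 0 < (M A B C).det) :
    openTriangle A B C =ᵐ[sphereArea] triangle A B C := by
  filter_upwards [ae_det_ne_zero h] with X hX
  apply propext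
  change X ∈ openTriangle A B C ↔ X ∈ triangle A B C
  rw [mem_triangle_iff h, mem_openTriangle_iff h]
  exact ⟨fun ⟨a, b, c⟩ => ⟨a.le, b.le, c.le⟩, fun ⟨a, b, c⟩ =>
    ⟨a.lt_of_ne' hX.1, b.lt_of_ne' hX.2.1, c.lt_of_ne' hX.2.2⟩⟩

/-- The point of the flat triangle `ABC` that divides the segment from `C` to
`(1 - s) A + s B` in the ratio `t : 1 - t`. -/
def flat (A B C : R3) (z : ℝ × ℝ) : R3 :=
  (1 - z.2) • C + z.2 • ((1 - z.1) • A + z.1 • B)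

theorem flat_eq_comb (A B C : R3) (z : ℝ × ℝ) :
    flat A B C z = (z.2 * (1 - z.1)) • A + (z.2 * z.1) • B + (1 - z.2) • C := by
  simp only [flat]
  module

theorem flat_ne_zero {A B C : R3} (h : (M A B C).det ≠ 0) (z : ℝ × ℝ) : flat A B C z ≠ 0 := by
  rw [flat_eq_comb]
  refine comb_ne_zero h ?_
  rintro ⟨h1, h2, h3⟩
  have : z.2 = 1 := by linarith
  rw [this] at h1 h2
  linarith

theorem continuous_flat (A B C : R3) : Continuous (flat A B C) := by
  unfold flat
  fun_prop

theorem measurable_radial : Measurable radial := by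
  unfold radial
  fun_prop

theorem norm_radial {x : R3} (hx : x ≠ 0) : ‖radial x‖ = 1 := by
  rw [radial, norm_smul, norm_inv, norm_norm, inv_mul_cancel₀ (norm_ne_zero_iff.mpr hx)]

/-- The Jacobian of the parametrization of the spherical triangle by the unit square. -/
def flatJac (A B C : R3) (z : ℝ × ℝ) : ℝ := z.2 * (M A B C).det / ‖flat A B C z‖ ^ 3

/-- The parametrization `(s, t, r) ↦ r • flat A B C (s, t)` of the cone over the triangle. -/
def coneMap (A B C : R3) (y : R3) : R3 := y 2 • flat A B C (y 0, y 1)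

/-- The derivative of `coneMap`. -/
def coneMapDeriv (A B C : R3) (y : R3) : R3 →L[ℝ] R3 :=
  Matrix.toEuclideanCLM (n := Fin 3) (𝕜 := ℝ)
    (M ((y 2 * y 1) • (B - A)) (y 2 • ((1 - y 0) • A + y 0 • B - C)) (flat A B C (y 0, y 1)))

theorem hasFDerivAt_coneMap (A B C y : R3) :
    HasFDerivAt (coneMap A B C) (coneMapDeriv A B C y) y := by
  have c : ∀ i, HasFDerivAt (fun y : R3 => y i) (coord i) y := fun i =>
    (EuclideanSpace.proj i : R3 →L[ℝ] ℝ).hasFDerivAt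
  have h := (c 2).smul ((((c 1).const_sub 1).smul_const C).add
    ((c 1).smul ((((c 0).const_sub 1).smul_const A).add ((c 0).smul_const B))))
  refine h.congr_fderiv ?_
  ext v i
  simp [coneMapDeriv, flat, coord, M, Matrix.mulVec, dotProduct, Fin.sum_univ_three]
  ring

/-- The order `(s, t, r)` reverses orientation, whence the sign; the change of variables takes
absolute values. -/
theorem det_coneMapDeriv (A B C y : R3) :
    (coneMapDeriv A B C y).det = - (y 2 ^ 2 * (y 1 * (M A B C).det)) := by
  rw [coneMapDeriv, ContinuousLinearMap.det, Matrix.coe_toEuclideanCLM_eq_toEuclideanLin,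
    Matrix.toEuclideanLin_eq_toLin_orthonormal, LinearMap.det_toLin]
  simp only [det_M, flat, PiLp.add_apply, PiLp.sub_apply, PiLp.smul_apply, smul_eq_mul]
  ring

theorem coneMap_eq_comb (A B C y : R3) : coneMap A B C y =
    (y 2 * (y 1 * (1 - y 0))) • A + (y 2 * (y 1 * y 0)) • B + (y 2 * (1 - y 1)) • C := by
  rw [coneMap, flat_eq_comb]
  module

theorem injOn_coneMap {A B C : R3} (h : (M A B C).det ≠ 0) :
    InjOn (coneMap A B C) {y | y 1 ≠ 0 ∧ y 2 ≠ 0} := by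
  intro x hx y hy hxy
  rw [coneMap_eq_comb, coneMap_eq_comb] at hxy
  have h1 := congrArg (fun X => (M B C X).det) hxy
  have h2 := congrArg (fun X => (M C A X).det) hxy
  have h3 := congrArg (fun X => (M A B X).det) hxy
  simp only [det_M_comb_left, det_M_comb_mid, det_M_comb] at h1 h2 h3
  have h1 := mul_right_cancel₀ h h1
  have h2 := mul_right_cancel₀ h h2
  have h3 := mul_right_cancel₀ h h3
  -- The three coefficients on `A`, `B`, `C` add up to the radial parameter.
  have e2 : x 2 = y 2 := by linear_combination h1 + h2 + h3
  rw [e2] at h1 h2 h3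
  have h1 := mul_left_cancel₀ hy.2 h1
  have h2 := mul_left_cancel₀ hy.2 h2
  have h3 := mul_left_cancel₀ hy.2 h3
  have e1 : x 1 = y 1 := by linear_combination -h3
  rw [e1] at h2
  have e0 := mul_left_cancel₀ hy.1 h2
  ext i
  fin_cases i <;> assumption

end

/-! ### Integration over a spherical triangle -/

section

open MeasureTheory Set
open scoped Pointwise

/-- The open unit square. -/
abbrev openSquare : Set (ℝ × ℝ) := Ioo 0 1 ×ˢ Ioo 0 1

/-- The coordinates of `ℝ³`, grouped as `(y₂, (y₀, y₁))`. -/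
def coordEquiv : R3 ≃ᵐ ℝ × ℝ × ℝ :=
  ((MeasurableEquiv.toLp 2 (Fin 3 → ℝ)).symm.trans
    (MeasurableEquiv.piFinSuccAbove (fun _ => ℝ) 2)).trans
    ((MeasurableEquiv.refl ℝ).prodCongr MeasurableEquiv.finTwoArrow)

theorem coordEquiv_apply (y : R3) : coordEquiv y = (y 2, y 0, y 1) := rfl

theorem measurePreserving_coordEquiv : MeasurePreserving coordEquiv volume volume := by
  have h1 : MeasurePreserving (MeasurableEquiv.toLp 2 (Fin 3 → ℝ)).symm :=
    EuclideanSpace.volume_preserving_symm_measurableEquiv_toLp (Fin 3)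
  have h2 := volume_preserving_piFinSuccAbove (fun _ : Fin 3 => ℝ) 2
  have h3 := (MeasurePreserving.id (volume : Measure ℝ)).prod (volume_preserving_finTwoArrow ℝ)
  exact h3.comp (h2.comp h1)

theorem radial_smul {r : ℝ} (hr : 0 < r) (x : R3) : radial (r • x) = radial x := by
  rw [radial, radial, norm_smul, Real.norm_of_nonneg hr.le, smul_smul]
  congr 1
  field_simp

theorem radial_of_norm_eq_one {X : R3} (hX : ‖X‖ = 1) : radial X = X := by simp [radial, hX]

theorem norm_smul_radial {x : R3} (hx : x ≠ 0) : ‖x‖ • radial x = x := by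
  rw [radial, smul_smul, mul_inv_cancel₀ (norm_ne_zero_iff.mpr hx), one_smul]

/-- The part of the parameter domain of the cone over the triangle that lies in the unit ball,
over those points of the triangle that belong to `G`. -/
def coneDomain (A B C : R3) (G : Set R3) : Set (ℝ × ℝ × ℝ) :=
  {w | (0 < w.1 ∧ w.1 * ‖flat A B C w.2‖ < 1) ∧
    (w.2 ∈ openSquare ∧ radial (flat A B C w.2) ∈ G)}

/-- The measure `toSphere` of a set is defined through the volume of the cone over it inside the
unit ball; this exhibits that cone as an image under `coneMap`. -/
theorem coneMap_image {A B C : R3} (h : 0 < (M A B C).det) (G : Set R3) :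
    coneMap A B C '' (coordEquiv ⁻¹' coneDomain A B C G) =
      Ioo (0 : ℝ) 1 • (Subtype.val '' ((Subtype.val ⁻¹' G : Set S2) ∩ openTriangle A B C)) := by
  ext x
  constructor
  · rintro ⟨y, ⟨⟨hr, hr1⟩, ⟨hs, ht⟩, hG⟩, rfl⟩
    simp only [coordEquiv_apply, mem_Ioo] at hr hr1 hs ht hG
    have h0 : flat A B C (y 0, y 1) ≠ 0 := flat_ne_zero h.ne' _
    have hn : 0 < ‖flat A B C (y 0, y 1)‖ := norm_pos_iff.mpr h0
    refine ⟨y 2 * ‖flat A B C (y 0, y 1)‖, ⟨by positivity, hr1⟩, radial (flat A B C (y 0, y 1)),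
      ⟨⟨_, mem_sphere_zero_iff_norm.mpr (norm_radial h0)⟩, ⟨hG, ?_⟩, rfl⟩, ?_⟩
    · have h1 : 0 < 1 - y 0 := by linarith
      have h2 : 0 < 1 - y 1 := by linarith
      have h3 := hs.1
      have h4 := ht.1
      refine ⟨‖flat A B C (y 0, y 1)‖⁻¹ * (y 1 * (1 - y 0)),
        ‖flat A B C (y 0, y 1)‖⁻¹ * (y 1 * y 0), ‖flat A B C (y 0, y 1)‖⁻¹ * (1 - y 1),
        by positivity, by positivity, by positivity, ?_⟩
      change ‖flat A B C (y 0, y 1)‖⁻¹ • flat A B C (y 0, y 1) = _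
      simp only [mul_smul ‖flat A B C (y 0, y 1)‖⁻¹, ← smul_add]
      exact congrArg _ (flat_eq_comb A B C (y 0, y 1))
    · change (y 2 * ‖flat A B C (y 0, y 1)‖) • radial (flat A B C (y 0, y 1)) = _
      rw [mul_smul, norm_smul_radial h0]
      rfl
  · rintro ⟨r, ⟨hr, hr1⟩, _, ⟨X, ⟨hG, a, b, c, ha, hb, hc, hX⟩, rfl⟩, rfl⟩
    have hXn : ‖(X : R3)‖ = 1 := by simp
    -- Rescaling by `a + b + c` puts the point in the plane of the flat triangle; `s` and `t` are
    -- then ratios of the coefficients.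
    have hflat : (a + b + c) • flat A B C (b / (a + b), (a + b) / (a + b + c)) = (X : R3) := by
      rw [hX, flat_eq_comb, smul_add, smul_add, smul_smul, smul_smul, smul_smul]
      congr 2
      · congr 1
        field_simp
        ring
      · congr 1
        field_simp
      · field_simp
        ring
    refine ⟨WithLp.toLp 2 ![b / (a + b), (a + b) / (a + b + c), r * (a + b + c)], ?_, ?_⟩
    · refine ⟨⟨?_, ?_⟩, ⟨⟨?_, ?_⟩, ⟨?_, ?_⟩⟩, ?_⟩
      · simp [coordEquiv_apply]
        positivity
      · simp only [coordEquiv_apply, Matrix.cons_val_zero, Matrix.cons_val_one, Matrix.cons_val]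
        have : ‖flat A B C (b / (a + b), (a + b) / (a + b + c))‖ = (a + b + c)⁻¹ := by
          have h1 := congrArg norm hflat
          rw [hXn, norm_smul, Real.norm_of_nonneg (by positivity)] at h1
          exact eq_inv_of_mul_eq_one_right h1
        rw [this, mul_assoc, mul_inv_cancel₀ (by positivity), mul_one]
        exact hr1
      · simp [coordEquiv_apply]
        positivity
      · simp [coordEquiv_apply]
        rw [div_lt_one (by positivity)]
        linarith
      · simp [coordEquiv_apply]
        positivity
      · simp [coordEquiv_apply]
        rw [div_lt_one (by positivity)]
        linarith
      · simp only [coordEquiv_apply, Matrix.cons_val_zero, Matrix.cons_val_one, Matrix.cons_val]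
        rw [← radial_smul (by positivity : 0 < a + b + c), hflat, radial_of_norm_eq_one hXn]
        exact hG
    · simp only [coneMap, Matrix.cons_val_zero, Matrix.cons_val_one, Matrix.cons_val]
      rw [mul_smul, hflat]

theorem measurableSet_coneDomain (A B C : R3) {G : Set R3} (hG : MeasurableSet G) :
    MeasurableSet (coneDomain A B C G) := by
  have hc := continuous_flat A B C
  change MeasurableSet (({w : ℝ × ℝ × ℝ | 0 < w.1} ∩ {w | w.1 * ‖flat A B C w.2‖ < 1}) ∩
    (Prod.snd ⁻¹' openSquare ∩ (fun w : ℝ × ℝ × ℝ => radial (flat A B C w.2)) ⁻¹' G))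
  refine MeasurableSet.inter (MeasurableSet.inter ?_ ?_) (MeasurableSet.inter ?_ ?_)
  · exact measurableSet_lt measurable_const measurable_fst
  · refine measurableSet_lt (Continuous.measurable ?_) measurable_const
    fun_prop
  · exact measurable_snd (measurableSet_Ioo.prod measurableSet_Ioo)
  · exact (measurable_radial.comp (hc.measurable.comp measurable_snd)) hG

/-- With `R = ‖flat‖⁻¹` this yields the inverse cube in `flatJac`; the `1 / 3` cancels the dimension
factor in `toSphere`. -/
theorem lintegral_sq_mul {R k : ℝ} (hR : 0 ≤ R) (hk : 0 ≤ k) :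
    ∫⁻ r in Ioo 0 R, ENNReal.ofReal (r ^ 2 * k) = ENNReal.ofReal (k * R ^ 3 / 3) := by
  rw [Measure.restrict_congr_set Ioo_ae_eq_Ioc, ← ofReal_integral_eq_lintegral_ofReal,
    ← intervalIntegral.integral_of_le hR]
  · congr 1
    rw [intervalIntegral.integral_mul_const, integral_pow]
    norm_num
    ring
  · have : Continuous fun r : ℝ => r ^ 2 * k := by fun_prop
    exact (this.intervalIntegrable 0 R).1
  · exact Filter.Eventually.of_forall fun r => by positivity

theorem sphereArea_inter_openTriangle {A B C : R3} (h : 0 < (M A B C).det) {G : Set R3}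
    (hG : MeasurableSet G) :
    sphereArea ((Subtype.val ⁻¹' G : Set S2) ∩ openTriangle A B C) =
      ∫⁻ z in openSquare ∩ (fun z => radial (flat A B C z)) ⁻¹' G,
        ENNReal.ofReal (flatJac A B C z) := by
  have hc := continuous_flat A B C
  have hm := measurableSet_coneDomain A B C hG
  have hZ : MeasurableSet (openSquare ∩ (fun z => radial (flat A B C z)) ⁻¹' G) :=
    (measurableSet_Ioo.prod measurableSet_Ioo).inter
      ((measurable_radial.comp hc.measurable) hG)
  have hinj : InjOn (coneMap A B C) (coordEquiv ⁻¹' coneDomain A B C G) :=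
    (injOn_coneMap h.ne').mono (by
      intro y hy
      exact ⟨hy.2.1.2.1.ne', hy.1.1.ne'⟩)
  rw [sphereArea, Measure.toSphere_apply' _
    ((measurable_subtype_coe hG).inter (measurableSet_openTriangle h)), ← coneMap_image h,
    ← lintegral_abs_det_fderiv_eq_addHaar_image volume (coordEquiv.measurable hm)
      (fun y _ => (hasFDerivAt_coneMap A B C y).hasFDerivWithinAt)
      hinj]
  have e1 : ∀ y, ENNReal.ofReal |(coneMapDeriv A B C y).det| =
      (fun w : ℝ × ℝ × ℝ => ENNReal.ofReal |w.1 ^ 2 * (w.2.2 * (M A B C).det)|)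
        (coordEquiv y) := by
    intro y
    rw [det_coneMapDeriv, abs_neg]
    rfl
  have e2 : Measurable fun w : ℝ × ℝ × ℝ =>
      ENNReal.ofReal |w.1 ^ 2 * (w.2.2 * (M A B C).det)| := by fun_prop
  simp_rw [e1]
  rw [measurePreserving_coordEquiv.setLIntegral_comp_preimage hm e2, ← lintegral_indicator hm]
  change _ * ∫⁻ w, _ ∂((volume : Measure ℝ).prod (volume : Measure (ℝ × ℝ))) = _
  rw [lintegral_prod_symm _ (e2.indicator hm).aemeasurable, ← lintegral_const_mul',
    ← lintegral_indicator hZ]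
  · congr 1
    ext z
    by_cases hz : z ∈ openSquare ∩ (fun z => radial (flat A B C z)) ⁻¹' G
    · rw [indicator_of_mem hz]
      have hn : 0 < ‖flat A B C z‖ := norm_pos_iff.mpr (flat_ne_zero h.ne' _)
      have hz2 : 0 < z.2 := hz.1.2.1
      -- For fixed `z` the admissible radii form the interval `(0, ‖flat‖⁻¹)`.
      have e3 : ∀ r : ℝ, (coneDomain A B C G).indicator
          (fun w : ℝ × ℝ × ℝ => ENNReal.ofReal |w.1 ^ 2 * (w.2.2 * (M A B C).det)|) (r, z) =
          (Ioo 0 ‖flat A B C z‖⁻¹).indicator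
            (fun r => ENNReal.ofReal (r ^ 2 * (z.2 * (M A B C).det))) r := by
        intro r
        by_cases hr : r ∈ Ioo 0 ‖flat A B C z‖⁻¹
        · have hr' : (r, z) ∈ coneDomain A B C G :=
            ⟨⟨hr.1, by
              have := hr.2
              rw [← one_div, lt_div_iff₀ hn] at this
              exact this⟩, hz⟩
          rw [indicator_of_mem hr, indicator_of_mem hr', abs_of_nonneg]
          positivity
        · have hr' : (r, z) ∉ coneDomain A B C G := fun hh =>
            hr ⟨hh.1.1, by
              have := hh.1.2
              rw [← one_div, lt_div_iff₀ hn]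
              exact this⟩
          rw [indicator_of_notMem hr, indicator_of_notMem hr']
      simp_rw [e3]
      rw [lintegral_indicator measurableSet_Ioo, lintegral_sq_mul (by positivity) (by positivity),
        finrank_euclideanSpace_fin]
      have : ((3 : ℕ) : ENNReal) = ENNReal.ofReal 3 := by simp
      rw [this, ← ENNReal.ofReal_mul (by norm_num)]
      congr 1
      rw [flatJac]
      field_simp
    · rw [indicator_of_notMem hz]
      have e3 : ∀ r : ℝ, (coneDomain A B C G).indicator
          (fun w : ℝ × ℝ × ℝ => ENNReal.ofReal |w.1 ^ 2 * (w.2.2 * (M A B C).det)|) (r, z) = 0 :=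
        fun r => indicator_of_notMem (fun hh => hz hh.2) _
      rw [lintegral_congr e3]
      simp
  · simp

theorem continuous_flatJac {A B C : R3} (h : 0 < (M A B C).det) : Continuous (flatJac A B C) := by
  unfold flatJac
  have hc := continuous_flat A B C
  exact Continuous.div (by fun_prop) (by fun_prop)
    fun z => pow_ne_zero _ (norm_ne_zero_iff.mpr (flat_ne_zero h.ne' z))

/-- Having the area formula for every measurable `G` makes it an equality of measures, so that it
extends to arbitrary integrands. -/
theorem map_sphereArea {A B C : R3} (h : 0 < (M A B C).det) :
    (sphereArea.restrict (openTriangle A B C)).map Subtype.val =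
      ((volume.restrict openSquare).withDensity
        fun z => ENNReal.ofReal (flatJac A B C z)).map fun z => radial (flat A B C z) := by
  have hr : Measurable fun z => radial (flat A B C z) :=
    measurable_radial.comp (continuous_flat A B C).measurable
  ext G hG
  rw [Measure.map_apply measurable_subtype_coe hG, Measure.map_apply hr hG,
    Measure.restrict_apply (measurable_subtype_coe hG), sphereArea_inter_openTriangle h hG,
    withDensity_apply _ (hr hG), Measure.restrict_restrict (hr hG), inter_comm]

/-- Integration over a spherical triangle in the parametrization by the unit square. -/
theorem integral_triangle {A B C : R3} (h : 0 < (M A B C).det) (f : R3 → ℝ)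
    (hf : AEStronglyMeasurable (fun X : S2 => f X) (sphereArea.restrict (triangle A B C))) :
    ∫ X in triangle A B C, f X ∂sphereArea =
      ∫ z in openSquare, flatJac A B C z * f (radial (flat A B C z)) := by
  have hr : Measurable fun z => radial (flat A B C z) :=
    measurable_radial.comp (continuous_flat A B C).measurable
  have hemb : MeasurableEmbedding (Subtype.val : S2 → R3) :=
    MeasurableEmbedding.subtype_coe Metric.isClosed_sphere.measurableSet
  rw [← Measure.restrict_congr_set (openTriangle_ae_eq h)] at hf ⊢
  have hf' := (hemb.aestronglyMeasurable_map_iff (g := f)).mpr hf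
  rw [← hemb.integral_map f, map_sphereArea h]
  rw [map_sphereArea h] at hf'
  rw [integral_map hr.aemeasurable hf', integral_withDensity_eq_integral_toReal_smul
    (continuous_flatJac h).measurable.ennreal_ofReal (by simp)]
  refine setIntegral_congr_fun (measurableSet_Ioo.prod measurableSet_Ioo) fun z hz => ?_
  have hz2 : 0 < z.2 := hz.2.1
  have : 0 ≤ flatJac A B C z := by
    unfold flatJac
    positivity
  simp only [smul_eq_mul, ENNReal.toReal_ofReal this]

end

/-! ### The area of a spherical triangle -/

section

open MeasureTheory Set

/-- The radicand is `‖(1 - t) C + t P‖²` with `‖C‖ = 1`, `‖P‖ = ρ` and `C·P = c`; the hypotheses are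
strict Cauchy–Schwarz. The antiderivative is explicit. -/
theorem integral_div_norm_cube {c ρ : ℝ} (h1 : -ρ < c) (h2 : c < ρ) :
    ∫ t in (0 : ℝ)..1, t / √((1 - t) ^ 2 + 2 * t * (1 - t) * c + t ^ 2 * ρ ^ 2) ^ 3 =
      1 / (ρ * (ρ + c)) := by
  have hρ : 0 < ρ := by linarith
  have hk : 0 < ρ ^ 2 - c ^ 2 := by nlinarith
  have hm : ∀ t : ℝ, 0 < (1 - t) ^ 2 + 2 * t * (1 - t) * c + t ^ 2 * ρ ^ 2 := by
    intro t
    have e : (1 - t) ^ 2 + 2 * t * (1 - t) * c + t ^ 2 * ρ ^ 2 =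
      (1 - t + c * t) ^ 2 + t ^ 2 * (ρ ^ 2 - c ^ 2) := by ring
    rw [e]
    rcases eq_or_ne t 0 with rfl | ht
    · norm_num
    · positivity
  have hd : ∀ t ∈ uIcc (0 : ℝ) 1, HasDerivAt
      (fun t => -((1 - t + c * t) /
        ((ρ ^ 2 - c ^ 2) * √((1 - t) ^ 2 + 2 * t * (1 - t) * c + t ^ 2 * ρ ^ 2))))
      (t / √((1 - t) ^ 2 + 2 * t * (1 - t) * c + t ^ 2 * ρ ^ 2) ^ 3) t := by
    intro t _
    have i := hasDerivAt_id t
    have d1 : HasDerivAt (fun t : ℝ => (1 - t) ^ 2 + 2 * t * (1 - t) * c + t ^ 2 * ρ ^ 2)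
        (-2 * (1 - t) + 2 * (1 - 2 * t) * c + 2 * t * ρ ^ 2) t := by
      refine ((((i.const_sub 1).pow 2).add (((i.const_mul 2).mul (i.const_sub 1)).mul_const c)).add
        ((i.pow 2).mul_const (ρ ^ 2))).congr_deriv ?_
      simp only [id]
      ring
    have d2 : HasDerivAt (fun t : ℝ => 1 - t + c * t) (-1 + c) t := by
      refine ((i.const_sub 1).add (i.const_mul c)).congr_deriv ?_
      ring
    have d3 := (d1.sqrt (hm t).ne').const_mul (ρ ^ 2 - c ^ 2)
    have hs := Real.sqrt_pos.mpr (hm t)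
    have d4 := (d2.div d3 (mul_pos hk hs).ne').neg
    refine d4.congr_deriv ?_
    have hsq := Real.sq_sqrt (hm t).le
    generalize √((1 - t) ^ 2 + 2 * t * (1 - t) * c + t ^ 2 * ρ ^ 2) = n at *
    field_simp
    linear_combination (1 - c) * hsq
  rw [intervalIntegral.integral_eq_sub_of_hasDerivAt hd]
  · have e1 : ((1 : ℝ) - 1) ^ 2 + 2 * 1 * (1 - 1) * c + 1 ^ 2 * ρ ^ 2 = ρ ^ 2 := by ring
    have e0 : ((1 : ℝ) - 0) ^ 2 + 2 * 0 * (1 - 0) * c + 0 ^ 2 * ρ ^ 2 = 1 := by ring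
    rw [e1, e0, Real.sqrt_one, Real.sqrt_sq hρ.le]
    have hp : ρ + c ≠ 0 := by linarith
    field_simp
    ring
  · apply ContinuousOn.intervalIntegrable
    refine Continuous.continuousOn (Continuous.div (by fun_prop) (by fun_prop) fun t => ?_)
    exact pow_ne_zero _ (Real.sqrt_pos.mpr (hm t)).ne'

/-- Here `κ = C·A`, `μ = A·B`, `ν = B·C`, `d = det M(A, B, C)`, and with `P = (1 - s) A + s B` one
has `ρ s = ‖P‖` and `(1 - s) κ + s ν = C·P`. -/
theorem integral_eq_arg {κ μ ν d : ℝ} (hκ : |κ| < 1) (hμ : |μ| < 1) (hd : 0 < d)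
    (hd2 : d ^ 2 = 1 - κ ^ 2 - μ ^ 2 - ν ^ 2 + 2 * κ * μ * ν) (ρ : ℝ → ℝ)
    (hρ : ρ = fun s => √((1 - s) ^ 2 + 2 * s * (1 - s) * μ + s ^ 2)) :
    (∀ s, 0 < ρ s) ∧ (∀ s, |(1 - s) * κ + s * ν| < ρ s) ∧
    ∫ s in (0 : ℝ)..1, d / (ρ s * (ρ s + ((1 - s) * κ + s * ν))) =
      2 * Complex.arg ⟨1 + κ + μ + ν, d⟩ := by
  obtain ⟨hκ1, hκ2⟩ := abs_lt.mp hκ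
  obtain ⟨hμ1, hμ2⟩ := abs_lt.mp hμ
  have hm : ∀ s : ℝ, 0 < (1 - s) ^ 2 + 2 * s * (1 - s) * μ + s ^ 2 := by
    intro s
    have e : (1 - s) ^ 2 + 2 * s * (1 - s) * μ + s ^ 2 =
      (1 - s + μ * s) ^ 2 + s ^ 2 * ((1 - μ) * (1 + μ)) := by ring
    rw [e]
    rcases eq_or_ne s 0 with rfl | hs
    · norm_num
    · have h3 : 0 < 1 - μ := by linarith
      have h4 : 0 < 1 + μ := by linarith
      positivity
  have hpos : ∀ s, 0 < ρ s := fun s => by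
    rw [hρ]
    exact Real.sqrt_pos.mpr (hm s)
  have hsq : ∀ s, ρ s ^ 2 = (1 - s) ^ 2 + 2 * s * (1 - s) * μ + s ^ 2 := fun s => by
    rw [hρ]
    exact Real.sq_sqrt (hm s).le
  have hκ' : 0 < 1 - κ ^ 2 := by nlinarith
  have hlt : ∀ s, |(1 - s) * κ + s * ν| < ρ s := by
    intro s
    refine abs_lt_of_sq_lt_sq ?_ (hpos s).le
    -- A sum of squares that vanishes only if `C` and `P` are parallel.
    have e : (1 - κ ^ 2) * (ρ s ^ 2 - ((1 - s) * κ + s * ν) ^ 2) =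
        ((1 - s) * (1 - κ ^ 2) + s * (μ - κ * ν)) ^ 2 + s ^ 2 * d ^ 2 := by
      rw [hsq, hd2]
      ring
    have h3 : 0 < ((1 - s) * (1 - κ ^ 2) + s * (μ - κ * ν)) ^ 2 + s ^ 2 * d ^ 2 := by
      rcases eq_or_ne s 0 with rfl | hs
      · simp
        exact pow_pos hκ' 2
      · positivity
    rw [← e] at h3
    have := (mul_pos_iff_of_pos_left hκ').mp h3
    linarith
  refine ⟨hpos, hlt, ?_⟩
  -- The number inside the logarithm is `ρ s` times the area phase of the partial triangle `A`, `P /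
  -- ‖P‖`, `C`; the positive factor does not change its argument.
  have hder : ∀ s ∈ uIcc (0 : ℝ) 1, HasDerivAt
      (fun s => 2 * (Complex.log (((ρ s * (1 + κ) + ((1 - s) + s * μ) + ((1 - s) * κ + s * ν) : ℝ) : ℂ)
        + ((s * d : ℝ) : ℂ) * Complex.I)).im)
      (d / (ρ s * (ρ s + ((1 - s) * κ + s * ν)))) s := by
    intro s hs
    rw [uIcc_of_le zero_le_one] at hs
    have i := hasDerivAt_id s
    have d1 : HasDerivAt (fun s : ℝ => (1 - s) ^ 2 + 2 * s * (1 - s) * μ + s ^ 2)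
        (-2 * (1 - s) + 2 * (1 - 2 * s) * μ + 2 * s) s := by
      refine ((((i.const_sub 1).pow 2).add (((i.const_mul 2).mul (i.const_sub 1)).mul_const μ)).add
        (i.pow 2)).congr_deriv ?_
      simp only [id]
      ring
    have d2 : HasDerivAt ρ ((-2 * (1 - s) + 2 * (1 - 2 * s) * μ + 2 * s) / (2 * ρ s)) s := by
      rw [hρ]
      exact d1.sqrt (hm s).ne'
    have d3 : HasDerivAt
        (fun s => ρ s * (1 + κ) + ((1 - s) + s * μ) + ((1 - s) * κ + s * ν))
        ((-2 * (1 - s) + 2 * (1 - 2 * s) * μ + 2 * s) / (2 * ρ s) * (1 + κ) + (-1 + μ)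
          + (-κ + ν)) s := by
      refine (((d2.mul_const (1 + κ)).add ((i.const_sub 1).add (i.mul_const μ))).add
        (((i.const_sub 1).mul_const κ).add (i.mul_const ν))).congr_deriv ?_
      ring
    have d4 : HasDerivAt (fun s : ℝ => s * d) d s := by
      simpa using i.mul_const d
    have d5 := d3.ofReal_comp.add (d4.ofReal_comp.mul_const Complex.I)
    have hp := hpos s
    have hl := abs_lt.mp (hlt s)
    have hslit : ((ρ s * (1 + κ) + ((1 - s) + s * μ) + ((1 - s) * κ + s * ν) : ℝ) : ℂ)
        + ((s * d : ℝ) : ℂ) * Complex.I ∈ Complex.slitPlane := by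
      rw [Complex.mem_slitPlane_iff]
      rcases eq_or_ne s 0 with rfl | hs0
      · left
        simp
        nlinarith
      · right
        simp [hs0, hd.ne']
    have d6 := (Complex.imCLM.hasFDerivAt.comp_hasDerivAt s (d5.clog_real hslit)).const_mul 2
    refine d6.congr_deriv ?_
    -- The homogeneous form of the factorization in `normSq_areaPhase`.
    have hN : Complex.normSq (((ρ s * (1 + κ) + ((1 - s) + s * μ) + ((1 - s) * κ + s * ν) : ℝ) : ℂ)
        + ((s * d : ℝ) : ℂ) * Complex.I) =
        2 * (ρ s + ((1 - s) + s * μ)) * (ρ s + ((1 - s) * κ + s * ν)) * (1 + κ) := by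
      rw [Complex.normSq_add_mul_I]
      linear_combination (κ ^ 2 - 1) * hsq s + s ^ 2 * hd2
    have hN0 := Complex.normSq_pos.mpr (Complex.slitPlane_ne_zero hslit)
    simp only [Pi.add_apply]
    rw [Complex.imCLM_apply, Complex.div_im, hN]
    rw [hN] at hN0
    simp only [Complex.add_re, Complex.add_im, Complex.ofReal_re, Complex.ofReal_im,
      Complex.re_ofReal_mul, Complex.im_ofReal_mul, Complex.I_re, Complex.I_im, mul_zero, mul_one,
      add_zero, zero_add]
    have hc : 0 < ρ s + ((1 - s) * κ + s * ν) := by linarith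
    rw [← sub_div, mul_div_assoc', div_eq_div_iff hN0.ne' (by positivity)]
    field_simp
    linear_combination ((1 + κ) * (ρ s + ((1 - s) * κ + s * ν))) * hsq s
  rw [intervalIntegral.integral_eq_sub_of_hasDerivAt hder]
  · have e1 : ρ 1 = 1 := by simp [hρ]
    have e0 : ρ 0 = 1 := by simp [hρ]
    rw [e0, e1]
    have a0 : (((1 : ℝ) * (1 + κ) + ((1 - 0) + 0 * μ) + ((1 - 0) * κ + 0 * ν) : ℝ) : ℂ)
        + (((0 : ℝ) * d : ℝ) : ℂ) * Complex.I = ((2 * (1 + κ) : ℝ) : ℂ) := by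
      push_cast
      ring
    rw [a0, Complex.log_im, Complex.log_im, Complex.arg_ofReal_of_nonneg (by linarith),
      Complex.mk_eq_add_mul_I]
    simp
  · apply ContinuousOn.intervalIntegrable
    have hc : Continuous ρ := by
      rw [hρ]
      fun_prop
    refine Continuous.continuousOn (Continuous.div (by fun_prop) (by fun_prop) fun s => ?_)
    have hl := abs_lt.mp (hlt s)
    have hp := hpos s
    have : 0 < ρ s + ((1 - s) * κ + s * ν) := by linarith
    positivity

/-- If `A·B = ±1`, the Gram determinant equals `-(B·C - (A·B)(A·C))² ≤ 0`. -/
theorem abs_inner_lt_one {A B C : R3} (hA : ‖A‖ = 1) (hB : ‖B‖ = 1) (hC : ‖C‖ = 1)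
    (h : (M A B C).det ≠ 0) : |(inner ℝ A B : ℝ)| < 1 := by
  have h1 := abs_real_inner_le_norm A B
  rw [hA, hB, one_mul] at h1
  refine lt_of_le_of_ne h1 fun h2 => ?_
  have h3 : (inner ℝ A B : ℝ) ^ 2 = 1 := by rw [← sq_abs, h2, one_pow]
  have h4 := det_M_sq hA hB hC
  have h5 : 0 < (M A B C).det ^ 2 := by positivity
  rw [real_inner_comm A C] at h4
  nlinarith [sq_nonneg ((inner ℝ B C : ℝ) - inner ℝ A B * inner ℝ A C),
    mul_self_nonneg ((inner ℝ B C : ℝ) - inner ℝ A B * inner ℝ A C)]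

theorem norm_flat {A B C : R3} (hA : ‖A‖ = 1) (hB : ‖B‖ = 1) (hC : ‖C‖ = 1) (s t : ℝ) :
    ‖flat A B C (s, t)‖ = √((1 - t) ^ 2 +
      2 * t * (1 - t) * ((1 - s) * inner ℝ C A + s * inner ℝ B C)
      + t ^ 2 * ((1 - s) ^ 2 + 2 * s * (1 - s) * inner ℝ A B + s ^ 2)) := by
  rw [norm_eq_sqrt_real_inner]
  congr 1
  simp only [flat, inner_add_left, inner_add_right, inner_smul_left, inner_smul_right, conj_trivial]
  rw [inner_self_eq_one hA, inner_self_eq_one hB, inner_self_eq_one hC, real_inner_comm C A,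
    real_inner_comm A B, real_inner_comm B C]
  ring

theorem integral_openSquare {f : ℝ × ℝ → ℝ} (hf : ContinuousOn f (Icc 0 1)) :
    ∫ z in openSquare, f z = ∫ s in (0 : ℝ)..1, ∫ t in (0 : ℝ)..1, f (s, t) := by
  have hi : IntegrableOn f openSquare :=
    (hf.integrableOn_compact isCompact_Icc).mono_set fun z hz =>
      ⟨⟨hz.1.1.le, hz.2.1.le⟩, ⟨hz.1.2.le, hz.2.2.le⟩⟩
  rw [show (volume : Measure (ℝ × ℝ)) = (volume : Measure ℝ).prod volume from rfl] at hi ⊢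
  rw [setIntegral_prod f hi, intervalIntegral.integral_of_le zero_le_one,
    integral_Ioc_eq_integral_Ioo]
  refine setIntegral_congr_fun measurableSet_Ioo fun s _ => ?_
  rw [intervalIntegral.integral_of_le zero_le_one, integral_Ioc_eq_integral_Ioo]

/-- On the unit square, `integral_div_norm_cube` does the integral in `t` and `integral_eq_arg` the
one in `s`. -/
theorem area_triangle {A B C : R3} (hA : ‖A‖ = 1) (hB : ‖B‖ = 1) (hC : ‖C‖ = 1)
    (h : 0 < (M A B C).det) :
    sphereArea.real (triangle A B C) = 2 * Complex.arg (areaPhase A B C) := by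
  have h1 : sphereArea.real (triangle A B C) =
      ∫ z in openSquare, flatJac A B C z * 1 := by
    rw [← integral_triangle h (fun _ => 1) aestronglyMeasurable_const]
    simp
  have hκ := abs_inner_lt_one hC hA hB (by rw [← det_M_cycle]; exact h.ne')
  have hμ := abs_inner_lt_one hA hB hC h.ne'
  have hd2 := det_M_sq hA hB hC
  obtain ⟨hp, hl, hint⟩ := integral_eq_arg hκ hμ h (ν := inner ℝ B C)
    (by linear_combination hd2) _ rfl
  simp only [mul_one] at h1
  rw [h1, integral_openSquare (continuous_flatJac h).continuousOn, areaPhase]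
  have e : (1 + inner ℝ A B + inner ℝ B C + inner ℝ C A : ℝ) =
      1 + inner ℝ C A + inner ℝ A B + inner ℝ B C := by ring
  rw [e, ← hint]
  refine intervalIntegral.integral_congr fun s _ => ?_
  obtain ⟨hl1, hl2⟩ := abs_lt.mp (hl s)
  have e2 := integral_div_norm_cube hl1 hl2
  have e3 : ∀ t, flatJac A B C (s, t) = (M A B C).det * (t / √((1 - t) ^ 2
      + 2 * t * (1 - t) * ((1 - s) * inner ℝ C A + s * inner ℝ B C)
      + t ^ 2 * √((1 - s) ^ 2 + 2 * s * (1 - s) * inner ℝ A B + s ^ 2) ^ 2) ^ 3) := by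
    intro t
    rw [flatJac, norm_flat hA hB hC, Real.sq_sqrt (Real.sqrt_pos.mp (hp s)).le]
    ring
  simp_rw [e3]
  rw [intervalIntegral.integral_const_mul, e2]
  ring

/-- Exchanging two vertices conjugates the phase, which settles negative orientation. For zero
determinant the slit plane forces a positive real phase, so both sides vanish. -/
theorem signedArea_eq {A B C : R3} (hA : ‖A‖ = 1) (hB : ‖B‖ = 1) (hC : ‖C‖ = 1)
    (h : areaPhase A B C ∈ Complex.slitPlane) :
    signedArea A B C = 2 * Complex.arg (areaPhase A B C) := by
  rcases lt_trichotomy (M A B C).det 0 with hd | hd | hd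
  · have h1 : 0 < (M B A C).det := by rw [det_M_swap]; linarith
    have h2 : triangle A B C = triangle B A C := by
      ext X
      constructor
      · rintro ⟨a, b, c, ha, hb, hc, hX⟩
        exact ⟨b, a, c, hb, ha, hc, by rw [hX]; abel⟩
      · rintro ⟨a, b, c, ha, hb, hc, hX⟩
        exact ⟨b, a, c, hb, ha, hc, by rw [hX]; abel⟩
    have h3 : areaPhase B A C = (starRingEnd ℂ) (areaPhase A B C) := by
      apply Complex.ext
      · simp only [areaPhase, Complex.conj_re]
        rw [real_inner_comm A B, real_inner_comm C A, real_inner_comm B C]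
        ring
      · simp only [areaPhase, Complex.conj_im]
        exact det_M_swap A B C
    have h4 : (areaPhase A B C).arg ≠ Real.pi := by
      exact (Complex.mem_slitPlane_iff_arg.mp h).1
    rw [signedArea, sign_neg hd, h2, area_triangle hB hA hC h1, h3, Complex.arg_conj, if_neg h4]
    simp
  · have h1 : 0 < (areaPhase A B C).re := by
      rcases Complex.mem_slitPlane_iff.mp h with h | h
      · exact h
      · exact absurd hd h
    have h2 : areaPhase A B C = ((areaPhase A B C).re : ℂ) := Complex.ext rfl hd
    rw [signedArea, hd, sign_zero, h2, Complex.arg_ofReal_of_nonneg h1.le]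
    simp
  · rw [signedArea, sign_pos hd, area_triangle hA hB hC hd]
    simp

end

/-! ### Smoothness and differential of the signed area -/

section

open MeasureTheory Set Filter Topology

theorem triangle_cycle (A B C : R3) : triangle B C A = triangle A B C := by
  ext X
  constructor
  · rintro ⟨a, b, c, ha, hb, hc, hX⟩
    exact ⟨c, a, b, hc, ha, hb, by rw [hX]; abel⟩
  · rintro ⟨a, b, c, ha, hb, hc, hX⟩
    exact ⟨b, c, a, hb, hc, ha, by rw [hX]; abel⟩

theorem signedArea_cycle (A B C : R3) : signedArea B C A = signedArea A B C := by
  rw [signedArea, signedArea, det_M_cycle, triangle_cycle]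

theorem signedArea_eq_zero {A B C : R3} (h : (M A B C).det = 0) : signedArea A B C = 0 := by
  simp [signedArea, h]

theorem signedArea_pos {A B C : R3} (hA : ‖A‖ = 1) (hB : ‖B‖ = 1) (hC : ‖C‖ = 1)
    (h : 0 < (M A B C).det) : 0 < signedArea A B C := by
  have him : (areaPhase A B C).im ≠ 0 := h.ne'
  rw [signedArea_eq hA hB hC (Complex.mem_slitPlane_iff.mpr (Or.inr him))]
  have h1 : 0 ≤ (areaPhase A B C).arg := Complex.arg_nonneg_iff.mpr h.le
  have h2 : (areaPhase A B C).arg ≠ 0 := fun h0 => him (Complex.arg_eq_zero_iff.mp h0).2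
  have := h1.lt_of_ne' h2
  linarith

/-- Off the side `BC` the imaginary part is nonzero. On it the real part factors as `(1 + b + c) (1
+ B·C)`, which is positive. -/
theorem areaPhase_mem_slitPlane {A B C : R3} (hA : ‖A‖ = 1) (hB : ‖B‖ = 1) (hC : ‖C‖ = 1)
    (h : 0 < (M A B C).det) {X : S2} (hX : X ∈ triangle A B C) :
    areaPhase B C X ∈ Complex.slitPlane := by
  obtain ⟨a, b, c, ha, hb, hc, hX⟩ := hX
  rw [Complex.mem_slitPlane_iff]
  rcases eq_or_ne a 0 with rfl | ha0
  · left
    have hBC := abs_lt.mp (abs_inner_lt_one hB hC hA (by rw [det_M_cycle]; exact h.ne'))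
    simp only [areaPhase, hX, inner_add_left, inner_add_right, inner_smul_left, inner_smul_right,
      conj_trivial, inner_self_eq_one hB, inner_self_eq_one hC]
    rw [real_inner_comm B C]
    have h1 : 0 < 1 + (inner ℝ B C : ℝ) := by linarith
    have h2 : 1 + inner ℝ B C + (0 * inner ℝ C A + b * inner ℝ B C + c * 1)
        + (0 * inner ℝ A B + b * 1 + c * inner ℝ B C)
        = (1 + b + c) * (1 + (inner ℝ B C : ℝ)) := by ring
    rw [h2]
    positivity
  · right
    change (M B C X).det ≠ 0
    rw [hX, det_M_comb_left]
    exact mul_ne_zero ha0 h.ne'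

theorem contDiffAt_radial {x : R3} (hx : x ≠ 0) : ContDiffAt ℝ ∞ radial x :=
  ((contDiffAt_norm ℝ hx).inv (norm_ne_zero_iff.mpr hx)).smul contDiffAt_id

/-- The linear part of `areaPhase B C`. -/
def areaPhaseLin (B C : R3) : R3 →L[ℝ] ℂ :=
  Complex.ofRealCLM.comp (innerSL ℝ (B + C))
    + Complex.I • Complex.ofRealCLM.comp (detLast B C).toContinuousLinearMap

theorem areaPhaseLin_apply (B C X : R3) :
    areaPhaseLin B C X = ⟨inner ℝ (B + C) X, (M B C X).det⟩ := by
  rw [Complex.mk_eq_add_mul_I]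
  simp [areaPhaseLin, detLast_apply, mul_comm, inner_add_left]

theorem areaPhase_eq (B C : R3) :
    areaPhase B C = fun X => ((1 + inner ℝ B C : ℝ) : ℂ) + areaPhaseLin B C X := by
  funext X
  rw [areaPhaseLin_apply]
  apply Complex.ext
  · simp only [areaPhase, Complex.add_re, Complex.ofReal_re, inner_add_left]
    rw [real_inner_comm B X]
    ring
  · simp [areaPhase]

theorem contDiff_areaPhase (B C : R3) : ContDiff ℝ ∞ (areaPhase B C) := by
  rw [areaPhase_eq]
  exact contDiff_const.add (areaPhaseLin B C).contDiff

theorem hasFDerivAt_areaPhase (B C X : R3) : HasFDerivAt (areaPhase B C) (areaPhaseLin B C) X := by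
  rw [areaPhase_eq]
  exact (areaPhaseLin B C).hasFDerivAt.const_add _

theorem signedArea_comp_radial_eventuallyEq {B C x : R3} (hB : ‖B‖ = 1) (hC : ‖C‖ = 1)
    (hx : x ≠ 0) (h : areaPhase B C (radial x) ∈ Complex.slitPlane) :
    signedArea B C ∘ radial =ᶠ[𝓝 x]
      fun y => 2 * Complex.imCLM (Complex.log (areaPhase B C (radial y))) := by
  have hc : ContinuousAt (fun y => areaPhase B C (radial y)) x :=
    (contDiff_areaPhase B C).continuous.continuousAt.comp (contDiffAt_radial hx).continuousAt
  filter_upwards [hc.preimage_mem_nhds (Complex.isOpen_slitPlane.mem_nhds h),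
    isOpen_ne.mem_nhds hx] with y hy hy0
  rw [Function.comp_apply, signedArea_eq hB hC (norm_radial hy0) hy, Complex.imCLM_apply,
    Complex.log_im]

theorem contDiffAt_signedArea {B C x : R3} (hB : ‖B‖ = 1) (hC : ‖C‖ = 1)
    (hx : x ≠ 0) (h : areaPhase B C (radial x) ∈ Complex.slitPlane) :
    ContDiffAt ℝ ∞ (signedArea B C ∘ radial) x := by
  refine ContDiffAt.congr_of_eventuallyEq ?_ (signedArea_comp_radial_eventuallyEq hB hC hx h)
  have h1 : ContDiffAt ℝ ∞ Complex.log (areaPhase B C (radial x)) :=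
    (Complex.contDiffAt_log h).restrict_scalars ℝ
  have h2 : ContDiffAt ℝ ∞ (fun y => areaPhase B C (radial y)) x :=
    (contDiff_areaPhase B C).contDiffAt.comp x (contDiffAt_radial hx)
  have h3 : ContDiffAt ℝ ∞ (fun y => Complex.log (areaPhase B C (radial y))) x :=
    ContDiffAt.comp (g := Complex.log) (f := fun y => areaPhase B C (radial y)) x h1 h2
  exact contDiffAt_const.mul (Complex.imCLM.contDiff.contDiffAt.comp x h3)

/-- Keeping the determinant on the left avoids dividing by it, so the identity survives on the great
circle `BC`. -/
theorem det_smul_sphereD_signedArea {B C X : R3} (hB : ‖B‖ = 1) (hC : ‖C‖ = 1) (hX : ‖X‖ = 1)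
    (h : areaPhase B C X ∈ Complex.slitPlane) :
    (M B C X).det • sphereD (signedArea B C) X = - dotdX (F B C X) X := by
  have h0 : X ≠ 0 := by
    rintro rfl
    simp at hX
  have hr := radial_of_norm_eq_one hX
  have e1 := signedArea_comp_radial_eventuallyEq hB hC h0 (by rwa [hr])
  have d1 : HasFDerivAt radial (dX X) X :=
    ((contDiffAt_radial h0).differentiableAt (by simp)).hasFDerivAt
  have d2 : HasFDerivAt (fun y => areaPhase B C (radial y))
      ((areaPhaseLin B C).comp (dX X)) X :=
    (hasFDerivAt_areaPhase B C _).comp X d1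
  have d3 := ((Complex.imCLM.hasFDerivAt.comp X
    ((Complex.hasStrictFDerivAt_log_real (by rwa [hr])).hasFDerivAt.comp X d2)).const_mul
      (2 : ℝ)).congr_of_eventuallyEq e1
  have hn : Complex.normSq (areaPhase B C X) ≠ 0 :=
    (Complex.normSq_pos.mpr (Complex.slitPlane_ne_zero h)).ne'
  have hn' := hn
  rw [normSq_areaPhase hB hC hX] at hn'
  -- A nonzero phase makes every factor of its squared modulus nonzero.
  have h1 : 1 + inner ℝ B X ≠ 0 := by
    rw [real_inner_comm]
    exact right_ne_zero_of_mul hn'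
  have h2 : 1 + inner ℝ C X ≠ 0 := right_ne_zero_of_mul (left_ne_zero_of_mul hn')
  rw [sphereD, d3.fderiv]
  ext v
  have hv : inner ℝ X (dX X v) = (0 : ℝ) := by
    rw [dX_apply hX, inner_sub_right, inner_smul_right, inner_self_eq_one hX]
    ring
  have key := inner_F_mul hB hC hX hv h1 h2
  simp only [smul_apply, ContinuousLinearMap.comp_apply, hr, areaPhaseLin_apply, smul_eq_mul,
    neg_apply, dotdX, innerSL_apply_apply, Complex.imCLM_apply,
    one_apply_eq_self, Complex.mul_im, Complex.inv_re, Complex.inv_im]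
  field_simp
  simp only [areaPhase] at key ⊢
  linear_combination key

end

/-! ### The Whitney 2-form -/

section

open MeasureTheory Set Filter Topology

theorem two_le_infty : (2 : WithTop ℕ∞) ≤ ∞ := by
  exact WithTop.coe_le_coe.mpr (le_top : (2 : ℕ∞) ≤ ⊤)

theorem toOneForm_apply (α : R3 →L[ℝ] ℝ) (v : Fin 1 → R3) : toOneForm α v = α (v 0) := by
  simp [toOneForm]

/-- `toOneForm` as a continuous linear map. -/
def toOneFormCLM : (R3 →L[ℝ] ℝ) →L[ℝ] R3 [⋀^Fin 1]→L[ℝ] ℝ :=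
  LinearMap.toContinuousLinearMap
    { toFun := toOneForm
      map_add' := fun α β => by
        ext v
        simp [toOneForm_apply]
      map_smul' := fun c α => by
        ext v
        simp [toOneForm_apply] }

theorem toOneFormCLM_apply (α : R3 →L[ℝ] ℝ) : toOneFormCLM α = toOneForm α := rfl

/-- `radial` is idempotent, so pulling the differential back along it gives the differential of the
radial extension. -/
theorem sphereD_comp_dX {g : R3 → ℝ} {x : R3} (hx : x ≠ 0)
    (hg : DifferentiableAt ℝ (g ∘ radial) (radial x)) :
    (sphereD g (radial x)).comp (dX x) = fderiv ℝ (g ∘ radial) x := by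
  have h1 : (g ∘ radial) ∘ radial =ᶠ[𝓝 x] g ∘ radial := by
    filter_upwards [isOpen_ne.mem_nhds hx] with y hy
    simp only [Function.comp_apply]
    rw [radial_of_norm_eq_one (norm_radial hy)]
  have h2 : DifferentiableAt ℝ radial x := (contDiffAt_radial hx).differentiableAt (by simp)
  rw [← h1.fderiv_eq, fderiv_comp x hg h2]
  rfl

/-- On the sphere, `d (f dg - g df) = 2 df ∧ dg`. -/
theorem sphereExtDeriv_whitney {f g : R3 → ℝ} {X : R3} (hX : ‖X‖ = 1)
    (hf : ContDiffAt ℝ ∞ (f ∘ radial) X) (hg : ContDiffAt ℝ ∞ (g ∘ radial) X) :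
    sphereExtDeriv (fun Y => toOneForm (f Y • sphereD g Y - g Y • sphereD f Y)) X =
      (2 : ℝ) • wedge (sphereD f X) (sphereD g X) := by
  have h0 : X ≠ 0 := by
    rintro rfl
    simp at hX
  have hr := radial_of_norm_eq_one hX
  have hc : ContinuousAt radial X := (contDiffAt_radial h0).continuousAt
  have ev : ∀ {k : R3 → ℝ}, ContDiffAt ℝ ∞ (k ∘ radial) X →
      ∀ᶠ x in 𝓝 X, DifferentiableAt ℝ (k ∘ radial) (radial x) := by
    intro k hk
    have h1 : ∀ᶠ y in 𝓝 X, DifferentiableAt ℝ (k ∘ radial) y :=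
      ((hk.of_le (m := 1) (by simp)).eventually (by simp)).mono fun y hy =>
        hy.differentiableAt (by simp)
    rw [← hr] at h1
    exact hc.eventually h1
  have hform : (fun x => (toOneForm (f (radial x) • sphereD g (radial x)
      - g (radial x) • sphereD f (radial x))).compContinuousLinearMap (dX x)) =ᶠ[𝓝 X]
      fun x => toOneFormCLM ((f ∘ radial) x • fderiv ℝ (g ∘ radial) x
        - (g ∘ radial) x • fderiv ℝ (f ∘ radial) x) := by
    filter_upwards [ev hf, ev hg, isOpen_ne.mem_nhds h0] with x hfx hgx hx
    rw [← sphereD_comp_dX hx hfx, ← sphereD_comp_dX hx hgx]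
    ext v
    simp [toOneFormCLM_apply, toOneForm_apply]
  have df := (hf.differentiableAt (by simp)).hasFDerivAt
  have dg := (hg.differentiableAt (by simp)).hasFDerivAt
  have ddf := ((hf.fderiv_right (m := 1) two_le_infty).differentiableAt (by simp)).hasFDerivAt
  have ddg := ((hg.fderiv_right (m := 1) two_le_infty).differentiableAt (by simp)).hasFDerivAt
  have sf : IsSymmSndFDerivAt ℝ (f ∘ radial) X := hf.isSymmSndFDerivAt (by simpa using two_le_infty)
  have sg : IsSymmSndFDerivAt ℝ (g ∘ radial) X := hg.isSymmSndFDerivAt (by simpa using two_le_infty)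
  have dα := (df.smul ddg).sub (dg.smul ddf)
  have dω := toOneFormCLM.hasFDerivAt.comp X dα
  rw [sphereExtDeriv, hform.extDeriv_eq]
  change extDeriv (toOneFormCLM ∘ ((f ∘ radial) • fderiv ℝ (g ∘ radial)
    - (g ∘ radial) • fderiv ℝ (f ∘ radial))) X = _
  ext v
  rw [extDeriv, dω.fderiv, ContinuousAlternatingMap.alternatizeUncurryFin_apply,
    ContinuousAlternatingMap.smul_apply, wedge_apply]
  simp [Fin.sum_univ_two, toOneFormCLM_apply, toOneForm_apply, Fin.removeNth, sphereD]
  -- Symmetry of the second derivatives cancels every term that is not a product of first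
  -- derivatives.
  have s1 := sf (v 0) (v 1)
  have s2 := sg (v 0) (v 1)
  rw [s1, s2]
  ring

theorem lamA_comp_radial (A B C : R3) :
    lamA A B C ∘ radial = fun x => (signedArea A B C)⁻¹ * (signedArea B C ∘ radial) x := by
  funext x
  simp only [Function.comp_apply, lamA]
  ring

theorem lamB_comp_radial (A B C : R3) :
    lamB A B C ∘ radial = fun x => (signedArea A B C)⁻¹ * (signedArea C A ∘ radial) x := by
  funext x
  simp only [Function.comp_apply, lamB]
  ring

/-- Stated at points off the sphere as well, since points of the flat triangle are needed for the
integral. -/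
theorem contDiffAt_lamA {A B C : R3} (hA : ‖A‖ = 1) (hB : ‖B‖ = 1) (hC : ‖C‖ = 1)
    (h : 0 < (M A B C).det) {x : R3} (hx : x ≠ 0) {X : S2} (hXx : radial x = X)
    (hX : X ∈ triangle A B C) : ContDiffAt ℝ ∞ (lamA A B C ∘ radial) x := by
  rw [lamA_comp_radial]
  exact contDiffAt_const.mul (contDiffAt_signedArea hB hC hx
    (by rw [hXx]; exact areaPhase_mem_slitPlane hA hB hC h hX))

theorem contDiffAt_lamB {A B C : R3} (hA : ‖A‖ = 1) (hB : ‖B‖ = 1) (hC : ‖C‖ = 1)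
    (h : 0 < (M A B C).det) {x : R3} (hx : x ≠ 0) {X : S2} (hXx : radial x = X)
    (hX : X ∈ triangle A B C) : ContDiffAt ℝ ∞ (lamB A B C ∘ radial) x := by
  rw [lamB_comp_radial]
  exact contDiffAt_const.mul (contDiffAt_signedArea hC hA hx
    (by
      rw [hXx]
      exact areaPhase_mem_slitPlane hB hC hA (by rwa [det_M_cycle]) (by rwa [triangle_cycle])))

theorem norm_coe_S2 (X : S2) : ‖(X : R3)‖ = 1 := by simp

theorem coe_S2_ne_zero (X : S2) : (X : R3) ≠ 0 := by
  rw [← norm_ne_zero_iff, norm_coe_S2]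
  exact one_ne_zero

theorem whitneyABC_eq_wedge {A B C : R3} (hA : ‖A‖ = 1) (hB : ‖B‖ = 1) (hC : ‖C‖ = 1)
    (h : 0 < (M A B C).det) {X : S2} (hX : X ∈ triangle A B C) :
    whitneyABC A B C X = (2 : ℝ) • wedge (sphereD (lamA A B C) X) (sphereD (lamB A B C) X) :=
  sphereExtDeriv_whitney (norm_coe_S2 X)
    (contDiffAt_lamA hA hB hC h (coe_S2_ne_zero X) (radial_of_norm_eq_one (norm_coe_S2 X)) hX)
    (contDiffAt_lamB hA hB hC h (coe_S2_ne_zero X) (radial_of_norm_eq_one (norm_coe_S2 X)) hX)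

theorem wedge_smul_smul (a b : ℝ) (α β : R3 →L[ℝ] ℝ) :
    wedge (a • α) (b • β) = (a * b) • wedge α β := by
  ext v
  simp only [wedge_apply, smul_apply, ContinuousAlternatingMap.smul_apply, smul_eq_mul]
  ring

theorem sphereD_lamA {A B C : R3} (hA : ‖A‖ = 1) (hB : ‖B‖ = 1) (hC : ‖C‖ = 1)
    (h : 0 < (M A B C).det) {X : S2} (hX : X ∈ triangle A B C) (hd : (M B C X).det ≠ 0) :
    sphereD (lamA A B C) X =
      (-(signedArea A B C * (M B C X).det)⁻¹) • dotdX (F B C X) X := by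
  have hs := areaPhase_mem_slitPlane hA hB hC h hX
  have h1 := det_smul_sphereD_signedArea hB hC (norm_coe_S2 X) hs
  have hD : DifferentiableAt ℝ (signedArea B C ∘ radial) X :=
    (contDiffAt_signedArea hB hC (coe_S2_ne_zero X)
      (by rwa [radial_of_norm_eq_one (norm_coe_S2 X)])).differentiableAt (by simp)
  have h2 : sphereD (lamA A B C) X = (signedArea A B C)⁻¹ • sphereD (signedArea B C) X := by
    rw [sphereD, lamA_comp_radial, fderiv_const_mul hD]
    rfl
  have hS := (signedArea_pos hA hB hC h).ne'
  rw [h2]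
  ext v
  have h3 : (M B C X).det * sphereD (signedArea B C) X v = -dotdX (F B C X) X v :=
    congrArg (fun L : R3 →L[ℝ] ℝ => L v) h1
  simp only [smul_apply, smul_eq_mul]
  field_simp
  linear_combination h3

theorem lamB_eq_lamA (A B C : R3) : lamB A B C = lamA B C A := by
  funext X
  rw [lamA, lamB, signedArea_cycle A B C]

theorem sphereD_lamB {A B C : R3} (hA : ‖A‖ = 1) (hB : ‖B‖ = 1) (hC : ‖C‖ = 1)
    (h : 0 < (M A B C).det) {X : S2} (hX : X ∈ triangle A B C) (hd : (M C A X).det ≠ 0) :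
    sphereD (lamB A B C) X =
      (-(signedArea A B C * (M C A X).det)⁻¹) • dotdX (F C A X) X := by
  rw [lamB_eq_lamA, sphereD_lamA hB hC hA (by rwa [det_M_cycle]) (by rwa [triangle_cycle]) hd,
    signedArea_cycle]

theorem whitneyABC_eq_wedge_dotdX {A B C : R3} (hA : ‖A‖ = 1) (hB : ‖B‖ = 1) (hC : ‖C‖ = 1)
    (h : 0 < (M A B C).det) {X : S2} (hX : X ∈ triangle A B C) (h1 : (M B C X).det ≠ 0)
    (h2 : (M C A X).det ≠ 0) : whitneyABC A B C X =
      (2 / (signedArea A B C ^ 2 * (M B C X * M C A X).det)) •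
        wedge (dotdX (F B C X) X) (dotdX (F C A X) X) := by
  rw [whitneyABC_eq_wedge hA hB hC h hX, sphereD_lamA hA hB hC h hX h1,
    sphereD_lamB hA hB hC h hX h2, wedge_smul_smul, smul_smul, Matrix.det_mul]
  have hS := (signedArea_pos hA hB hC h).ne'
  congr 1
  field_simp

theorem whitneyABC_eq_vol2 {A B C : R3} (hA : ‖A‖ = 1) (hB : ‖B‖ = 1) (hC : ‖C‖ = 1)
    (h : 0 < (M A B C).det) {X : S2} (hX : X ∈ triangle A B C) (h1 : (M B C X).det ≠ 0)
    (h2 : (M C A X).det ≠ 0) :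
    whitneyABC A B C X = (omegaABC A B C X / signedArea A B C) • vol2 X := by
  rw [whitneyABC_eq_wedge_dotdX hA hB hC h hX h1 h2, wedge_dotdX _ _ (norm_coe_S2 X), smul_smul,
    omegaABC]
  congr 1
  have hS := (signedArea_pos hA hB hC h).ne'
  rw [Matrix.det_mul]
  field_simp

/-! ### Rationality -/

/-- The coordinate-wise polynomial functions on `ℝ³`. -/
def IsPolynomial (f : R3 → ℝ) : Prop :=
  ∃ P : MvPolynomial (Fin 3) ℝ, ∀ X : R3, f X = MvPolynomial.eval (fun i => X i) P

namespace IsPolynomial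

theorem const (c : ℝ) : IsPolynomial fun _ => c := ⟨MvPolynomial.C c, fun X => by simp⟩

theorem coord (i : Fin 3) : IsPolynomial fun X => X i := ⟨MvPolynomial.X i, fun X => by simp⟩

theorem add {f g : R3 → ℝ} (hf : IsPolynomial f) (hg : IsPolynomial g) :
    IsPolynomial fun X => f X + g X := by
  obtain ⟨P, hP⟩ := hf
  obtain ⟨Q, hQ⟩ := hg
  exact ⟨P + Q, fun X => by simp [hP, hQ]⟩

theorem mul {f g : R3 → ℝ} (hf : IsPolynomial f) (hg : IsPolynomial g) :
    IsPolynomial fun X => f X * g X := by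
  obtain ⟨P, hP⟩ := hf
  obtain ⟨Q, hQ⟩ := hg
  exact ⟨P * Q, fun X => by simp [hP, hQ]⟩

theorem sub {f g : R3 → ℝ} (hf : IsPolynomial f) (hg : IsPolynomial g) :
    IsPolynomial fun X => f X - g X := by
  obtain ⟨P, hP⟩ := hf
  obtain ⟨Q, hQ⟩ := hg
  exact ⟨P - Q, fun X => by simp [hP, hQ]⟩

theorem inner_left (V : R3) : IsPolynomial fun X => inner ℝ V X := by
  simp only [inner_eq_sum]
  exact (((const _).mul (coord 0)).add ((const _).mul (coord 1))).add ((const _).mul (coord 2))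

theorem det {U V W : R3 → R3} (hU : ∀ i, IsPolynomial fun X => U X i)
    (hV : ∀ i, IsPolynomial fun X => V X i) (hW : ∀ i, IsPolynomial fun X => W X i) :
    IsPolynomial fun X => (M (U X) (V X) (W X)).det := by
  simp only [det_M]
  exact (((hU 0).mul (((hV 1).mul (hW 2)).sub ((hV 2).mul (hW 1)))).add
    ((hU 1).mul (((hV 2).mul (hW 0)).sub ((hV 0).mul (hW 2))))).add
    ((hU 2).mul (((hV 0).mul (hW 1)).sub ((hV 1).mul (hW 0))))

end IsPolynomial

/-- The vector `(1 + B·X) (1 + C·X) F_BC(X)`. -/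
def clearedF (B C X : R3) : R3 :=
  ((1 + inner ℝ C X) * (1 + inner ℝ B X - inner ℝ C X - inner ℝ C B)) • B
    + ((1 + inner ℝ B X) * (1 + inner ℝ C X - inner ℝ B X - inner ℝ B C)) • C

theorem smul_F {B C X : R3} (hB : 1 + inner ℝ B X ≠ 0) (hC : 1 + inner ℝ C X ≠ 0) :
    ((1 + inner ℝ B X) * (1 + inner ℝ C X)) • F B C X = clearedF B C X := by
  simp only [F, clearedF, smul_add, smul_smul, inner_add_right]
  congr 2
  · field_simp
    ring
  · field_simp
    ring

theorem isPolynomial_clearedF (B C : R3) (i : Fin 3) :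
    IsPolynomial fun X => clearedF B C X i := by
  simp only [clearedF, PiLp.add_apply, PiLp.smul_apply, smul_eq_mul]
  have c := fun V => (IsPolynomial.const 1).add (IsPolynomial.inner_left V)
  exact (((c C).mul (((c B).sub (.inner_left C)).sub (.const _))).mul (.const _)).add
    (((c B).mul (((c C).sub (.inner_left B)).sub (.const _))).mul (.const _))

/-- The determinant is linear in each of its first two columns, so scaling both `F`s to `clearedF`
multiplies it by the product of their denominators, which goes into `Q`. -/
theorem omegaABC_rational {A B C : R3} (hS : signedArea A B C ≠ 0) :
    ∃ P Q : MvPolynomial (Fin 3) ℝ, ∀ X : R3,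
      1 + inner ℝ A X ≠ 0 → 1 + inner ℝ B X ≠ 0 → 1 + inner ℝ C X ≠ 0 →
      (M B C X).det ≠ 0 → (M C A X).det ≠ 0 →
        MvPolynomial.eval (fun i => X i) Q ≠ 0 ∧
        omegaABC A B C X =
          MvPolynomial.eval (fun i => X i) P / MvPolynomial.eval (fun i => X i) Q := by
  have c := fun V => (IsPolynomial.const 1).add (IsPolynomial.inner_left V)
  have d := fun U V : R3 => IsPolynomial.det (U := fun _ => U) (V := fun _ => V) (W := fun X => X)
    (fun i => .const _) (fun i => .const _) .coord
  obtain ⟨P, hP⟩ := (IsPolynomial.const 2).mul (IsPolynomial.det (W := fun X => X)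
    (isPolynomial_clearedF B C) (isPolynomial_clearedF C A) .coord)
  obtain ⟨Q, hQ⟩ := (((c B).mul (c C)).mul ((c C).mul (c A))).mul
    ((IsPolynomial.const (signedArea A B C)).mul ((d B C).mul (d C A)))
  refine ⟨P, Q, fun X hA hB hC h1 h2 => ?_⟩
  rw [← hP, ← hQ]
  refine ⟨by positivity, ?_⟩
  have e : ∀ (a b : ℝ) (U V : R3), (M (a • U) (b • V) X).det = a * b * (M U V X).det := by
    intro a b U V
    simp only [det_M, PiLp.smul_apply, smul_eq_mul]
    ring
  beta_reduce
  rw [← smul_F hB hC, ← smul_F hC hA, e, omegaABC, Matrix.det_mul]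
  field_simp

end

/-! ### Green's theorem and additivity of the area -/

section

open MeasureTheory Set Filter Topology

/-- Green's theorem for the Whitney 2-form of barycentric coordinates on the unit square. -/
theorem integral_square_whitney {a b : ℝ × ℝ → ℝ}
    (ha : ∀ z ∈ Icc (0 : ℝ × ℝ) 1, ContDiffAt ℝ ∞ a z)
    (hb : ∀ z ∈ Icc (0 : ℝ × ℝ) 1, ContDiffAt ℝ ∞ b z)
    (hb0 : ∀ t, b (0, t) = 0) (ha1 : ∀ t, a (1, t) = 0) (ha0 : ∀ s, a (s, 0) = 0)
    (hab : ∀ s ∈ Icc (0 : ℝ) 1, a (s, 1) + b (s, 1) = 1) :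
    ∫ z in Icc (0 : ℝ × ℝ) 1, 2 * (fderiv ℝ a z (0, 1) * fderiv ℝ b z (1, 0)
      - fderiv ℝ a z (1, 0) * fderiv ℝ b z (0, 1)) = 1 := by
  have da : ∀ z ∈ Icc (0 : ℝ × ℝ) 1, HasFDerivAt a (fderiv ℝ a z) z := fun z hz =>
    ((ha z hz).differentiableAt (by simp)).hasFDerivAt
  have db : ∀ z ∈ Icc (0 : ℝ × ℝ) 1, HasFDerivAt b (fderiv ℝ b z) z := fun z hz =>
    ((hb z hz).differentiableAt (by simp)).hasFDerivAt
  have ca' : ∀ v, ContinuousOn (fun z => fderiv ℝ a z v) (Icc (0 : ℝ × ℝ) 1) := fun v z hz =>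
    (((ha z hz).fderiv_right (m := 1) two_le_infty).continuousAt.clm_apply
      continuousAt_const).continuousWithinAt
  have cb' : ∀ v, ContinuousOn (fun z => fderiv ℝ b z v) (Icc (0 : ℝ × ℝ) 1) := fun v z hz =>
    (((hb z hz).fderiv_right (m := 1) two_le_infty).continuousAt.clm_apply
      continuousAt_const).continuousWithinAt
  have ca : ContinuousOn a (Icc (0 : ℝ × ℝ) 1) := fun z hz =>
    (ha z hz).continuousAt.continuousWithinAt
  have ddb : ∀ z ∈ Icc (0 : ℝ × ℝ) 1,
      HasFDerivAt (fderiv ℝ b) (fderiv ℝ (fderiv ℝ b) z) z := fun z hz =>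
    (((hb z hz).fderiv_right (m := 1) two_le_infty).differentiableAt (by simp)).hasFDerivAt
  have dbv : ∀ v, ∀ z ∈ Icc (0 : ℝ × ℝ) 1,
      HasFDerivAt (fun z => fderiv ℝ b z v) ((fderiv ℝ (fderiv ℝ b) z).flip v) z := by
    intro v z hz
    refine ((ddb z hz).clm_apply (hasFDerivAt_const v z)).congr_fderiv ?_
    ext <;> simp
  -- The field `(-2 a ∂ₜb, 2 a ∂ₛb)` has the integrand as its divergence, the mixed second
  -- derivatives of `b` cancelling.
  have df : ∀ z ∈ Icc (0 : ℝ × ℝ) 1, HasFDerivAt (fun z => -2 * (a z * fderiv ℝ b z (0, 1)))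
      ((-2 : ℝ) • (a z • (fderiv ℝ (fderiv ℝ b) z).flip (0, 1)
        + fderiv ℝ b z (0, 1) • fderiv ℝ a z)) z := fun z hz =>
    ((da z hz).mul (dbv (0, 1) z hz)).const_mul (-2)
  have dg : ∀ z ∈ Icc (0 : ℝ × ℝ) 1, HasFDerivAt (fun z => 2 * (a z * fderiv ℝ b z (1, 0)))
      ((2 : ℝ) • (a z • (fderiv ℝ (fderiv ℝ b) z).flip (1, 0)
        + fderiv ℝ b z (1, 0) • fderiv ℝ a z)) z := fun z hz =>
    ((da z hz).mul (dbv (1, 0) z hz)).const_mul 2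
  have hdiv : EqOn (fun z => ((-2 : ℝ) • (a z • (fderiv ℝ (fderiv ℝ b) z).flip (0, 1)
        + fderiv ℝ b z (0, 1) • fderiv ℝ a z)) (1, 0)
      + ((2 : ℝ) • (a z • (fderiv ℝ (fderiv ℝ b) z).flip (1, 0)
        + fderiv ℝ b z (1, 0) • fderiv ℝ a z)) (0, 1))
      (fun z => 2 * (fderiv ℝ a z (0, 1) * fderiv ℝ b z (1, 0)
      - fderiv ℝ a z (1, 0) * fderiv ℝ b z (0, 1))) (Icc 0 1) := by
    intro z hz
    have sb : IsSymmSndFDerivAt ℝ b z :=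
      (hb z hz).isSymmSndFDerivAt (by simpa using two_le_infty)
    have := sb (1, 0) (0, 1)
    simp only [smul_apply, add_apply, ContinuousLinearMap.flip_apply, smul_eq_mul, this]
    ring
  have hI : IntegrableOn (fun z => 2 * (fderiv ℝ a z (0, 1) * fderiv ℝ b z (1, 0)
      - fderiv ℝ a z (1, 0) * fderiv ℝ b z (0, 1))) (Icc (0 : ℝ × ℝ) 1) :=
    (continuousOn_const.mul (((ca' _).mul (cb' _)).sub
      ((ca' _).mul (cb' _)))).integrableOn_compact isCompact_Icc
  have hsub : ∀ z ∈ Ioo (0 : ℝ × ℝ).1 (1 : ℝ × ℝ).1 ×ˢ Ioo (0 : ℝ × ℝ).2 (1 : ℝ × ℝ).2,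
      z ∈ Icc (0 : ℝ × ℝ) 1 := fun z hz =>
    ⟨⟨hz.1.1.le, hz.2.1.le⟩, ⟨hz.1.2.le, hz.2.2.le⟩⟩
  have green := integral_divergence_prod_Icc_of_hasFDerivAt_of_le
    (fun z => -2 * (a z * fderiv ℝ b z (0, 1))) (fun z => 2 * (a z * fderiv ℝ b z (1, 0))) _ _
    (0 : ℝ × ℝ) 1 zero_le_one (continuousOn_const.mul (ca.mul (cb' _)))
    (continuousOn_const.mul (ca.mul (cb' _))) (fun z hz => df z (hsub z hz))
    (fun z hz => dg z (hsub z hz)) (hI.congr_fun hdiv.symm measurableSet_Icc)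
  rw [← setIntegral_congr_fun measurableSet_Icc hdiv, green]
  simp only [Prod.fst_zero, Prod.fst_one, Prod.snd_zero, Prod.snd_one]
  have i2 : ∫ s in (0 : ℝ)..1, 2 * (a (s, 0) * fderiv ℝ b (s, 0) (1, 0)) = 0 := by
    simp [ha0]
  have i3 : ∫ t in (0 : ℝ)..1, -2 * (a (1, t) * fderiv ℝ b (1, t) (0, 1)) = 0 := by
    simp [ha1]
  have i4 : ∫ t in (0 : ℝ)..1, -2 * (a (0, t) * fderiv ℝ b (0, t) (0, 1)) = 0 := by
    refine (intervalIntegral.integral_congr fun t ht => ?_).trans intervalIntegral.integral_zero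
    rw [uIcc_of_le zero_le_one] at ht
    have h1 : HasDerivAt (fun t => ((0 : ℝ), t)) (0, 1) t :=
      (hasDerivAt_const t (0 : ℝ)).prodMk (hasDerivAt_id t)
    have h2 := (db (0, t) ⟨⟨le_rfl, ht.1⟩, ⟨zero_le_one, ht.2⟩⟩).comp_hasDerivAt t h1
    have h3 : b ∘ (fun t => ((0 : ℝ), t)) = fun _ => 0 := funext hb0
    rw [h3] at h2
    simp [h2.unique (hasDerivAt_const t (0 : ℝ))]
  -- On this edge `a = 1 - b`, so the integrand is the derivative of `2 b - b²`, and `b` runs from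
  -- `0` to `1`.
  have i1 : ∫ s in (0 : ℝ)..1, 2 * (a (s, 1) * fderiv ℝ b (s, 1) (1, 0)) = 1 := by
    have hd : ∀ s ∈ uIcc (0 : ℝ) 1, HasDerivAt (fun s => 2 * b (s, 1) - b (s, 1) ^ 2)
        (2 * (a (s, 1) * fderiv ℝ b (s, 1) (1, 0))) s := by
      intro s hs
      rw [uIcc_of_le zero_le_one] at hs
      have h1 : HasDerivAt (fun s => (s, (1 : ℝ))) (1, 0) s :=
        (hasDerivAt_id s).prodMk (hasDerivAt_const s (1 : ℝ))
      have h2 : HasDerivAt (fun s => b (s, 1)) (fderiv ℝ b (s, 1) (1, 0)) s :=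
        (db (s, 1) ⟨⟨hs.1, zero_le_one⟩, ⟨hs.2, le_rfl⟩⟩).comp_hasDerivAt s h1
      refine ((h2.const_mul 2).sub (h2.pow 2)).congr_deriv ?_
      rw [eq_sub_of_add_eq (hab s hs)]
      simp
      ring
    have hc : ContinuousOn (fun s : ℝ => (s, (1 : ℝ))) (uIcc 0 1) := by fun_prop
    have hm : MapsTo (fun s : ℝ => (s, (1 : ℝ))) (uIcc 0 1) (Icc (0 : ℝ × ℝ) 1) := by
      intro s hs
      rw [uIcc_of_le zero_le_one] at hs
      exact ⟨⟨hs.1, zero_le_one⟩, ⟨hs.2, le_rfl⟩⟩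
    rw [intervalIntegral.integral_eq_sub_of_hasDerivAt hd
      (continuousOn_const.mul ((ca.comp hc hm).mul ((cb' _).comp hc hm))).intervalIntegrable]
    have e1 : b (1, 1) = 1 := by
      have := hab 1 ⟨zero_le_one, le_rfl⟩
      rwa [ha1, zero_add] at this
    rw [e1, hb0]
    norm_num
  rw [i1, i2, i3, i4]
  norm_num

instance : IsFiniteMeasure sphereArea :=
  inferInstanceAs (IsFiniteMeasure (volume : Measure R3).toSphere)

/-- Cutting a spherical triangle by a great circle through `C`. -/
theorem signedArea_add {A B C X : R3} (h : 0 < (M A B C).det) {α β : ℝ} (hα : 0 < α) (hβ : 0 < β)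
    (hX : X = α • A + β • B) :
    signedArea B C X + signedArea C A X = signedArea A B C := by
  have hX' : X = α • A + β • B + (0 : ℝ) • C := by rw [hX]; simp
  have d1 : 0 < (M B C X).det := by
    rw [hX', det_M_comb_left]
    positivity
  have d2 : 0 < (M C A X).det := by
    rw [hX', det_M_comb_mid]
    positivity
  have hun : triangle B C X ∪ triangle C A X = triangle A B C := by
    ext Y
    constructor
    · rintro (⟨b, c, x, hb, hc, hx, hY⟩ | ⟨c, a, x, hc, ha, hx, hY⟩)
      · refine ⟨x * α, b + x * β, c, by positivity, by positivity, hc, ?_⟩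
        rw [hY, hX]
        module
      · refine ⟨a + x * α, x * β, c, by positivity, by positivity, hc, ?_⟩
        rw [hY, hX]
        module
    · rintro ⟨a, b, c, ha, hb, hc, hY⟩
      -- The sign of `b α - a β` is that of `det M(C, X, Y)`: it tells on which side of the great
      -- circle `CX` the point lies.
      rcases le_total (a * β) (b * α) with hle | hle
      · left
        refine ⟨b - a / α * β, c, a / α, ?_, hc, by positivity, ?_⟩
        · rw [div_mul_eq_mul_div, sub_nonneg, div_le_iff₀ hα]
          exact hle
        · rw [hY, hX, smul_add, smul_smul, smul_smul, div_mul_cancel₀ _ hα.ne']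
          module
      · right
        refine ⟨c, a - b / β * α, b / β, hc, ?_, by positivity, ?_⟩
        · rw [div_mul_eq_mul_div, sub_nonneg, div_le_iff₀ hβ]
          exact hle
        · rw [hY, hX, smul_add, smul_smul, smul_smul, div_mul_cancel₀ _ hβ.ne']
          module
  have hdis : AEDisjoint sphereArea (triangle B C X) (triangle C A X) := by
    refine measure_mono_null ?_ (sphereArea_greatCircle (U := C) (V := X) (W := B)
      (by rw [det_M_cycle]; exact d1.ne'))
    rintro Y ⟨hY1, hY2⟩
    have h1 := ((mem_triangle_iff d1 Y).mp hY1).2.1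
    have h2 := ((mem_triangle_iff d2 Y).mp hY2).2.2
    have h3 := ((mem_triangle_iff d1 Y).mp hY1).1
    have h4 := ((mem_triangle_iff d2 Y).mp hY2).2.1
    rw [det_M_swap] at h4
    exact le_antisymm (by linarith) h3
  rw [signedArea, signedArea, signedArea, sign_pos d1, sign_pos d2, sign_pos h, ← hun]
  simp only [SignType.coe_one, one_mul]
  rw [measureReal_def, measureReal_def, measureReal_def,
    measure_union₀ (isClosed_triangle d2).measurableSet.nullMeasurableSet hdis,
    ENNReal.toReal_add]
  · exact measure_ne_top _ _
  · exact measure_ne_top _ _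

end

/-! ### The integral of the Whitney 2-form -/

section

open MeasureTheory Set Filter Topology

/-- `radial` is homogeneous of degree 0, so its derivative is homogeneous of degree -1. -/
theorem dX_eq_smul {x : R3} (hx : x ≠ 0) : dX x = ‖x‖⁻¹ • dX (radial x) := by
  have hn : 0 < ‖x‖⁻¹ := inv_pos.mpr (norm_pos_iff.mpr hx)
  have h1 : radial = fun y => radial (‖x‖⁻¹ • y) := funext fun y => (radial_smul hn y).symm
  rw [dX, dX]
  conv_lhs => rw [h1]
  rw [fderiv_comp_smul]
  rfl

/-- The radial parts removed by `dX` are multiples of the first column, and each column contributes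
one factor `‖x‖⁻¹`. This is the source of the cube in `flatJac`. -/
theorem det_M_dX {x : R3} (hx : x ≠ 0) (u v : R3) :
    (M (radial x) (dX x u) (dX x v)).det = (M x u v).det / ‖x‖ ^ 3 := by
  have hn := norm_ne_zero_iff.mpr hx
  rw [dX_eq_smul hx]
  simp only [smul_apply, dX_apply (norm_radial hx)]
  generalize (inner ℝ (radial x) u : ℝ) = p
  generalize (inner ℝ (radial x) v : ℝ) = q
  simp only [radial, det_M, PiLp.sub_apply, PiLp.smul_apply, smul_eq_mul]
  field_simp
  ring

theorem inner_radial_dX {x : R3} (hx : x ≠ 0) (u : R3) : inner ℝ (radial x) (dX x u) = (0 : ℝ) := by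
  rw [dX_eq_smul hx, smul_apply, inner_smul_right, dX_apply (norm_radial hx), inner_sub_right,
    inner_smul_right, inner_self_eq_one (norm_radial hx)]
  ring

/-- The derivative of `flat`. -/
theorem hasFDerivAt_flat (A B C : R3) (z : ℝ × ℝ) : ∃ L : ℝ × ℝ →L[ℝ] R3,
    HasFDerivAt (flat A B C) L z ∧ L (1, 0) = z.2 • (B - A) ∧
      L (0, 1) = (1 - z.1) • A + z.1 • B - C := by
  have h1 : HasFDerivAt (fun z : ℝ × ℝ => z.1) (ContinuousLinearMap.fst ℝ ℝ ℝ) z := hasFDerivAt_fst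
  have h2 : HasFDerivAt (fun z : ℝ × ℝ => z.2) (ContinuousLinearMap.snd ℝ ℝ ℝ) z := hasFDerivAt_snd
  refine ⟨_, ((h2.const_sub 1).smul_const C).add
    (h2.smul (((h1.const_sub 1).smul_const A).add (h1.smul_const B))), ?_, ?_⟩
  · simp
    module
  · simp
    module

theorem contDiff_flat (A B C : R3) : ContDiff ℝ ∞ (flat A B C) := by
  unfold flat
  fun_prop

theorem det_M_flat (A B C : R3) (z : ℝ × ℝ) :
    (M (flat A B C z) ((1 - z.1) • A + z.1 • B - C) (z.2 • (B - A))).det =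
      z.2 * (M A B C).det := by
  simp only [det_M, flat, PiLp.add_apply, PiLp.sub_apply, PiLp.smul_apply, smul_eq_mul]
  ring

theorem radial_flat_mem {A B C : R3} (h : (M A B C).det ≠ 0) {z : ℝ × ℝ}
    (hz : z ∈ Icc (0 : ℝ × ℝ) 1) :
    ∃ X : S2, radial (flat A B C z) = X ∧ X ∈ triangle A B C := by
  obtain ⟨⟨h1, h2⟩, ⟨h3, h4⟩⟩ := hz
  simp only [Prod.fst_zero, Prod.fst_one, Prod.snd_zero, Prod.snd_one] at h1 h2 h3 h4
  have h0 := flat_ne_zero h z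
  have h5 : 0 ≤ 1 - z.1 := by linarith
  have h6 : 0 ≤ 1 - z.2 := by linarith
  refine ⟨⟨radial (flat A B C z), mem_sphere_zero_iff_norm.mpr (norm_radial h0)⟩, rfl,
    ‖flat A B C z‖⁻¹ * (z.2 * (1 - z.1)), ‖flat A B C z‖⁻¹ * (z.2 * z.1),
    ‖flat A B C z‖⁻¹ * (1 - z.2), by positivity, by positivity, by positivity, ?_⟩
  change ‖flat A B C z‖⁻¹ • flat A B C z = _
  simp only [mul_smul ‖flat A B C z‖⁻¹, ← smul_add]
  exact congrArg _ (flat_eq_comb A B C z)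

theorem continuousOn_density {f g : R3 → ℝ} {T : Set S2}
    (hf : ∀ X ∈ T, ContDiffAt ℝ ∞ (f ∘ radial) (X : R3))
    (hg : ∀ X ∈ T, ContDiffAt ℝ ∞ (g ∘ radial) (X : R3)) :
    ContinuousOn (fun X : S2 => density (wedge (sphereD f X) (sphereD g X)) X) T := by
  have cX : ∀ X : S2, ContinuousAt (Subtype.val : S2 → R3) X := fun X =>
    continuous_subtype_val.continuousAt
  have cd : ∀ {k : R3 → ℝ}, (∀ X ∈ T, ContDiffAt ℝ ∞ (k ∘ radial) (X : R3)) →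
      ContinuousOn (fun X : S2 => sphereD k X) T := fun hk X hX =>
    (ContinuousAt.comp (g := fderiv ℝ _) ((hk X hX).fderiv_right (m := 1) two_le_infty).continuousAt
      (cX X)).continuousWithinAt
  have cr : ∀ v, Continuous fun X : S2 => dX X v := fun v =>
    continuous_iff_continuousAt.mpr fun X =>
      (ContinuousAt.comp (g := fderiv ℝ radial) ((contDiffAt_radial (coe_S2_ne_zero X)).fderiv_right
        (m := 1) two_le_infty).continuousAt (cX X)).clm_apply continuousAt_const
  simp only [density, wedge_apply]
  refine continuousOn_finsetSum _ fun i _ => ContinuousOn.mul ?_ ?_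
  · exact Continuous.continuousOn (by fun_prop)
  · exact (((cd hf).clm_apply (cr _).continuousOn).mul ((cd hg).clm_apply (cr _).continuousOn)).sub
      (((cd hf).clm_apply (cr _).continuousOn).mul ((cd hg).clm_apply (cr _).continuousOn))

theorem continuousOn_density_whitneyABC {A B C : R3} (hA : ‖A‖ = 1) (hB : ‖B‖ = 1) (hC : ‖C‖ = 1)
    (h : 0 < (M A B C).det) :
    ContinuousOn (fun X : S2 => density (whitneyABC A B C X) X) (triangle A B C) := by
  refine ContinuousOn.congr (f := fun X : S2 =>
    2 * density (wedge (sphereD (lamA A B C) X) (sphereD (lamB A B C) X)) X) ?_ ?_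
  · exact continuousOn_const.mul (continuousOn_density
      (fun X hX => contDiffAt_lamA hA hB hC h (coe_S2_ne_zero X)
        (radial_of_norm_eq_one (norm_coe_S2 X)) hX)
      (fun X hX => contDiffAt_lamB hA hB hC h (coe_S2_ne_zero X)
        (radial_of_norm_eq_one (norm_coe_S2 X)) hX))
  · intro X hX
    simp only
    rw [whitneyABC_eq_wedge hA hB hC h hX, density_smul]

/-- The Whitney 2-form in the parametrization of the triangle by the unit square. -/
theorem flatJac_mul_density {A B C : R3} (hA : ‖A‖ = 1) (hB : ‖B‖ = 1) (hC : ‖C‖ = 1)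
    (h : 0 < (M A B C).det) {z : ℝ × ℝ} (hz : z ∈ Icc (0 : ℝ × ℝ) 1) :
    flatJac A B C z *
        density (whitneyABC A B C (radial (flat A B C z))) (radial (flat A B C z)) =
      2 * (fderiv ℝ ((lamA A B C ∘ radial) ∘ flat A B C) z (0, 1)
          * fderiv ℝ ((lamB A B C ∘ radial) ∘ flat A B C) z (1, 0)
        - fderiv ℝ ((lamA A B C ∘ radial) ∘ flat A B C) z (1, 0)
          * fderiv ℝ ((lamB A B C ∘ radial) ∘ flat A B C) z (0, 1)) := by
  obtain ⟨X, hXx, hX⟩ := radial_flat_mem h.ne' hz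
  obtain ⟨L, hL, hL1, hL2⟩ := hasFDerivAt_flat A B C z
  have h0 : flat A B C z ≠ 0 := flat_ne_zero h.ne' z
  have hXX := radial_of_norm_eq_one (norm_coe_S2 X)
  have e : ∀ {k : R3 → ℝ}, (∀ {x : R3}, x ≠ 0 → radial x = X → ContDiffAt ℝ ∞ (k ∘ radial) x) →
      ∀ v, fderiv ℝ ((k ∘ radial) ∘ flat A B C) z v = sphereD k X (dX (flat A B C z) (L v)) := by
    intro k hk v
    have h1 := sphereD_comp_dX (g := k) h0
      (by rw [hXx]; exact (hk (coe_S2_ne_zero X) hXX).differentiableAt (by simp))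
    rw [((((hk h0 hXx).differentiableAt (by simp)).hasFDerivAt).comp z hL).fderiv, ← h1, hXx]
    rfl
  rw [e (fun hx hx' => contDiffAt_lamA hA hB hC h hx hx' hX),
    e (fun hx hx' => contDiffAt_lamA hA hB hC h hx hx' hX),
    e (fun hx hx' => contDiffAt_lamB hA hB hC h hx hx' hX),
    e (fun hx hx' => contDiffAt_lamB hA hB hC h hx hx' hX), hXx]
  have hw := whitneyABC_eq_wedge hA hB hC h hX
  -- Taking the `t`-direction before the `s`-direction gives the outward orientation, so the
  -- determinant matches `flatJac` in sign.
  have h1 := alternating_eq_density_mul (whitneyABC A B C X) (norm_coe_S2 X)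
    (hXx ▸ inner_radial_dX h0 (L (0, 1))) (hXx ▸ inner_radial_dX h0 (L (1, 0)))
  have h2 := det_M_dX h0 (L (0, 1)) (L (1, 0))
  rw [hXx, hL1, hL2, det_M_flat, ← hL1, ← hL2] at h2
  rw [h2] at h1
  rw [flatJac, mul_comm, ← h1, hw, ContinuousAlternatingMap.smul_apply, wedge_apply]
  rfl

/-- A point strictly inside the side `AB` cuts the triangle in two; at an end one piece degenerates
and the other is the whole triangle. -/
theorem lamA_add_lamB {A B C X : R3} (hA : ‖A‖ = 1) (hB : ‖B‖ = 1) (hC : ‖C‖ = 1)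
    (h : 0 < (M A B C).det) {s : ℝ} (hs : s ∈ Icc (0 : ℝ) 1)
    (hX : X = (1 - s) • A + s • B) :
    lamA A B C (radial X) + lamB A B C (radial X) = 1 := by
  have hS := (signedArea_pos hA hB hC h).ne'
  rw [lamA, lamB, ← add_div, div_eq_one_iff_eq hS]
  rcases hs.1.eq_or_lt with rfl | h0
  · have : X = A := by rw [hX]; simp
    rw [this, radial_of_norm_eq_one hA, signedArea_cycle,
      signedArea_eq_zero (A := C) (by rw [det_M]; ring), add_zero]
  rcases hs.2.eq_or_lt with rfl | h1
  · have : X = B := by rw [hX]; simp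
    rw [this, radial_of_norm_eq_one hB, signedArea_cycle B C A, signedArea_cycle A B C,
      signedArea_eq_zero (A := B) (by rw [det_M]; ring), zero_add]
  have hX0 : X ≠ 0 := by
    have := comb_ne_zero h.ne' (a := 1 - s) (b := s) (c := 0) (by
      rintro ⟨-, h2, -⟩
      exact h0.ne' h2)
    rw [hX]
    simpa using this
  have hn : 0 < ‖X‖⁻¹ := inv_pos.mpr (norm_pos_iff.mpr hX0)
  have h2 : 0 < 1 - s := by linarith
  refine signedArea_add h (mul_pos hn h2) (mul_pos hn h0) ?_
  rw [mul_smul, mul_smul, ← smul_add, ← hX]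
  rfl

theorem integral2_whitneyABC {A B C : R3} (hA : ‖A‖ = 1) (hB : ‖B‖ = 1) (hC : ‖C‖ = 1)
    (h : 0 < (M A B C).det) : integral2 (triangle A B C) (whitneyABC A B C) = 1 := by
  rw [integral2, integral_triangle h (fun x => density (whitneyABC A B C x) x)
    ((continuousOn_density_whitneyABC hA hB hC h).aestronglyMeasurable
      (isClosed_triangle h).measurableSet)]
  have hsq : openSquare =ᵐ[volume] Icc (0 : ℝ × ℝ) 1 := by
    rw [show Icc (0 : ℝ × ℝ) 1 = Icc (0 : ℝ) 1 ×ˢ Icc (0 : ℝ) 1 from Icc_prod_eq 0 1]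
    exact Measure.set_prod_ae_eq Ioo_ae_eq_Icc Ioo_ae_eq_Icc
  rw [setIntegral_congr_set hsq, setIntegral_congr_fun measurableSet_Icc
    fun z hz => flatJac_mul_density hA hB hC h hz]
  have hz0 : ∀ {U V : R3} (x : R3), (M U V x).det = 0 → signedArea U V (radial x) = 0 := by
    intro U V x hx
    apply signedArea_eq_zero
    have : detLast U V (radial x) = 0 := by
      rw [radial, map_smul, detLast_apply, hx, smul_zero]
    exact this
  -- The edge `s = 0` maps to the side `CA`, `s = 1` to `BC` and `t = 1` to `AB`, while `t = 0`
  -- collapses to the vertex `C`.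
  refine integral_square_whitney ?_ ?_ ?_ ?_ ?_ ?_
  · intro z hz
    obtain ⟨X, hXx, hX⟩ := radial_flat_mem h.ne' hz
    exact (contDiffAt_lamA hA hB hC h (flat_ne_zero h.ne' z) hXx hX).comp z
      (contDiff_flat A B C).contDiffAt
  · intro z hz
    obtain ⟨X, hXx, hX⟩ := radial_flat_mem h.ne' hz
    exact (contDiffAt_lamB hA hB hC h (flat_ne_zero h.ne' z) hXx hX).comp z
      (contDiff_flat A B C).contDiffAt
  · intro t
    simp only [Function.comp_apply, lamB]
    rw [hz0 _ (by rw [flat_eq_comb, det_M_comb_mid]; simp), zero_div]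
  · intro t
    simp only [Function.comp_apply, lamA]
    rw [hz0 _ (by rw [flat_eq_comb, det_M_comb_left]; simp), zero_div]
  · intro s
    simp only [Function.comp_apply, lamA]
    rw [hz0 _ (by rw [flat_eq_comb, det_M_comb_left]; simp), zero_div]
  · intro s hs
    exact lamA_add_lamB hA hB hC h hs (by simp [flat])

end

end SphericalWhitney

end

open SphericalWhitney

theorem mainTheorem6 (A B C : R3) (hA : ‖A‖ = 1) (hB : ‖B‖ = 1) (hC : ‖C‖ = 1)
    (hdet : 0 < (M A B C).det) :
    (∀ X : S2, X ∈ triangle A B C →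
      ContDiffAt ℝ ∞ (lamA A B C ∘ radial) (X : R3) ∧
      ContDiffAt ℝ ∞ (lamB A B C ∘ radial) (X : R3) ∧
      whitneyABC A B C X =
        (2 : ℝ) • wedge (sphereD (lamA A B C) X) (sphereD (lamB A B C) X)) ∧
    (∀ X : S2, X ∈ triangle A B C → (M B C X).det ≠ 0 → (M C A X).det ≠ 0 →
      whitneyABC A B C X =
        (2 / (signedArea A B C ^ 2 * (M B C X * M C A X).det)) •
          wedge (dotdX (F B C X) X) (dotdX (F C A X) X) ∧
      whitneyABC A B C X = (omegaABC A B C X / signedArea A B C) • vol2 X) ∧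
    (∃ P Q : MvPolynomial (Fin 3) ℝ, ∀ X : R3,
      1 + inner ℝ A X ≠ 0 → 1 + inner ℝ B X ≠ 0 → 1 + inner ℝ C X ≠ 0 →
      (M B C X).det ≠ 0 → (M C A X).det ≠ 0 →
        MvPolynomial.eval (fun i => X i) Q ≠ 0 ∧
        omegaABC A B C X = MvPolynomial.eval (fun i => X i) P / MvPolynomial.eval (fun i => X i) Q) ∧
    MeasureTheory.IntegrableOn (fun X : S2 => density (whitneyABC A B C X) X)
      (triangle A B C) sphereArea ∧
    integral2 (triangle A B C) (whitneyABC A B C) = 1 ∧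
    ∫ X in triangle A B C, omegaABC A B C X / signedArea A B C ∂sphereArea = 1 := by
  refine ⟨fun X hX => ⟨?_, ?_, whitneyABC_eq_wedge hA hB hC hdet hX⟩, fun X hX h1 h2 =>
    ⟨whitneyABC_eq_wedge_dotdX hA hB hC hdet hX h1 h2, whitneyABC_eq_vol2 hA hB hC hdet hX h1 h2⟩,
    omegaABC_rational (signedArea_pos hA hB hC hdet).ne', ?_, integral2_whitneyABC hA hB hC hdet,
    ?_⟩
  · exact contDiffAt_lamA hA hB hC hdet (coe_S2_ne_zero X)
      (radial_of_norm_eq_one (norm_coe_S2 X)) hX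
  · exact contDiffAt_lamB hA hB hC hdet (coe_S2_ne_zero X)
      (radial_of_norm_eq_one (norm_coe_S2 X)) hX
  · exact (continuousOn_density_whitneyABC hA hB hC hdet).integrableOn_compact
      (isClosed_triangle hdet).isCompact
  · rw [← integral2_whitneyABC hA hB hC hdet, integral2]
    -- The formula with `omegaABC` can fail only on the sides, a null set.
    refine MeasureTheory.setIntegral_congr_ae (isClosed_triangle hdet).measurableSet ?_
    filter_upwards [ae_det_ne_zero hdet] with X hd hX
    rw [whitneyABC_eq_vol2 hA hB hC hdet hX hd.1 hd.2.1, density_smul,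
      density_vol2 (norm_coe_S2 X), mul_one]
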